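/- Let $\Phi$ be a reduced crystallographic root system of type $\mathsf{A}_\ell$ with $\ell\ge 4$, $\mathsf{D}_\ell$ with $\ell\ge 5$, or $\mathsf{E}_\ell$ with $\ell\in\{6,7,8\}$, and let $N_{\alpha,\beta}=\pm1$ (for $\alpha,\beta,\alpha+\beta\in\Phi$) be the structure constants of a Chevalley basis of the split semisimple Lie algebra of type $\Phi$, that is, $[e_\alpha,e_\beta]=N_{\alpha,\beta}e_{\alpha+\beta}$, $[e_\alpha,e_{-\alpha}]=\alpha^\vee$ and $N_{-\alpha,-\beta}=-N_{\alpha,\beta}$. For a commutative ring $S$, let $\mathrm{St}(\Phi,S)$ be the Steinberg group: the group with generators $x_\alpha(a)$, $\alpha\in\Phi$, $a\in S$, and relations $x_\alpha(a)x_\alpha(b)=x_\alpha(a+b)$; $[x_\alpha(a),x_\beta(b)]=x_{\alpha+\beta}(N_{\alpha,\beta}ab)$ if $\alpha+\beta\in\Phi$; $[x_\alpha(a),x_\beta(b)]=1$ if $\alpha+\beta\notin\Phi\cup\{0\}$. Here $[x,y]=xyx^{-1}y^{-1}$. Let $A$ be a commutative ring and $M$ an ideal of $A$. Put $t=X^{-1}$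 and let $B=A[t]+M[t^{-1}]\subseteq A[t,t^{-1}]$, graded by $\deg t=1$, so that its homogeneous components are $B_d=At^d$ for $d\ge0$ and $B_d=Mt^d$ for $d<0$. For an integer $n\ge1$ let $\mathrm{St}^{\le n}(\Phi,B)$ be the group with generators $x_\alpha(a)$, where $\alpha\in\Phi$ and $a\in B_d$ for some $d\le n$, and the following relations, where $d,e\le n$, $a,a'\in B_d$, $b\in B_e$: \begin{itemize} \item $x_\alpha(a)x_\alpha(a')=x_\alpha(a+a')$; \item $[x_\alpha(a),x_\beta(b)]=x_{\alpha+\beta}(N_{\alpha,\beta}ab)$ if $\alpha+\beta\in\Phi$ and $d+e\le n$; \item $[x_\alpha(a),x_\beta(b)]=1$ if $\alpha-\beta\in\Phi$; \item $[x_\alpha(a),x_\beta(b)]=1$ if $\alpha\perp\beta$. \end{itemize} Then for every $n\ge1$ the homomorphism $i_n\colon\mathrm{St}^{\le n}(\Phi,B)\to\mathrm{St}^{\le n+1}(\Phi,B)$, $x_\alpha(a)\mapsto x_\alpha(a)$, is an isomorphism. Moreover, there is a homomorphism $\mathrm{St}^{\le1}(\Phi,B)\to\mathrm{St}(\Phi,B)$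 with $x_\alpha(a)\mapsto x_\alpha(a)$, and it is an isomorphism. -/

import Mathlib

namespace GradedSteinberg

section RootSystem

variable {ι K V W : Type*} [Field K] [CharZero K] [AddCommGroup V] [Module K V]
  [AddCommGroup W] [Module K W]

/-- The root pairing `P` has a base whose Cartan matrix is `C`, up to numbering the simple roots. -/
def HasCartanMatrix (P : RootPairing ι K V W) [P.IsCrystallographic] {l : ℕ}
    (C : Matrix (Fin l) (Fin l) ℤ) : Prop :=
  ∃ (b : P.Base) (e : b.support ≃ Fin l), ∀ i j, b.cartanMatrix i j = C (e i) (e j)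

/-- `P` is of type `A_l` with `l ≥ 4`, `D_l` with `l ≥ 5`, `E₆`, `E₇` or `E₈`
(`CartanMatrix.A l` and `CartanMatrix.D l` are the `l × l` Cartan matrices of rank `l`). -/
def IsTypeADE (P : RootPairing ι K V W) [P.IsCrystallographic] : Prop :=
  (∃ l : ℕ, 4 ≤ l ∧ HasCartanMatrix P (CartanMatrix.A l)) ∨
  (∃ l : ℕ, 5 ≤ l ∧ HasCartanMatrix P (CartanMatrix.D l)) ∨
  HasCartanMatrix P CartanMatrix.E₆ ∨
  HasCartanMatrix P CartanMatrix.E₇ ∨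
  HasCartanMatrix P CartanMatrix.E₈

/-- A Chevalley basis of the split semisimple Lie algebra `L` with root system `P`. The map `h`
identifies the coroot space `W` with the split Cartan subalgebra of `L`, and `e i` is the root
vector of the root `P.root i`. The integers `N i j`, meaningful only if `P.root i + P.root j` is a
root, are the structure constants. -/
structure ChevalleyBasis (P : RootPairing ι K V W) (L : Type*) [LieRing L] [LieAlgebra K L] where
  /-- the inclusion of the Cartan subalgebra -/
  h : W →ₗ[K] L
  /-- the root vectors -/
  e : ι → L
  /-- the structure constants -/
  N : ι → ι → ℤ
  h_injective : Function.Injective h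
  e_linearIndependent : LinearIndependent K e
  isCompl : IsCompl (LinearMap.range h) (Submodule.span K (Set.range e))
  lie_h_h : ∀ w w' : W, ⁅h w, h w'⁆ = 0
  lie_h_e : ∀ (w : W) (i : ι), ⁅h w, e i⁆ = P.toLinearMap (P.root i) w • e i
  lie_e_neg : ∀ i j : ι, P.root j = -P.root i → ⁅e i, e j⁆ = h (P.coroot i)
  lie_e_add : ∀ i j k : ι, P.root k = P.root i + P.root j → ⁅e i, e j⁆ = N i j • e k
  lie_e_eq_zero : ∀ i j : ι, P.root i + P.root j ≠ 0 →
    P.root i + P.root j ∉ Set.range P.root → ⁅e i, e j⁆ = 0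
  N_neg : ∀ i j i' j' : ι, P.root i + P.root j ∈ Set.range P.root →
    P.root i' = -P.root i → P.root j' = -P.root j → N i' j' = -N i j

end RootSystem

noncomputable section Ring

open scoped LaurentPolynomial

variable {A : Type*} [CommRing A]

/-- The subring `B = A[t] + M[t⁻¹]` of the Laurent polynomial ring `A[t, t⁻¹]`, where `T 1` plays
the role of `t = X⁻¹`: the coefficients at the negative powers of `t` lie in `M`. -/
def ringB (M : Ideal A) : Subring A[T;T⁻¹] where
  carrier := {f | ∀ d : ℤ, d < 0 → f.coeff d ∈ M}
  zero_mem' := by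
    intro d _
    simp
  one_mem' := by
    intro d hd
    rw [← LaurentPolynomial.T_zero, LaurentPolynomial.T, AddMonoidAlgebra.coeff_single,
      Finsupp.single_eq_of_ne (by omega)]
    exact M.zero_mem
  add_mem' := by
    intro f g hf hg d hd
    simpa using M.add_mem (hf d hd) (hg d hd)
  neg_mem' := by
    intro f hf d hd
    simpa using M.neg_mem (hf d hd)
  mul_mem' := by
    intro f g hf hg d hd
    rw [AddMonoidAlgebra.coeff_mul]
    refine Ideal.sum_mem _ fun i _ => Ideal.sum_mem _ fun j _ => ?_
    dsimp only
    split_ifs with hij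
    · rcases lt_or_ge i 0 with hi | hi
      · exact M.mul_mem_right _ (hf i hi)
      · exact M.mul_mem_left _ (hg j (by omega))
    · exact M.zero_mem

/-- The homogeneous component `B_d` of `B`, for the grading in which `t` has degree `1`. -/
def homB (M : Ideal A) (d : ℤ) : AddSubgroup (ringB M) :=
  (AddMonoidAlgebra.grade A d).toAddSubgroup.comap (ringB M).subtype.toAddMonoidHom

/-- The homogeneous elements of `B` of degree at most `n`. -/
abbrev HomCoeff (M : Ideal A) (n : ℤ) : Type _ :=
  {a : ringB M // ∃ d : ℤ, d ≤ n ∧ a ∈ homB M d}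

end Ring

noncomputable section Groups

open scoped commutatorElement

variable {ι K V W : Type*} [Field K] [AddCommGroup V] [Module K V] [AddCommGroup W] [Module K W]
  (P : RootPairing ι K V W) (N : ι → ι → ℤ)

open FreeGroup in
/-- The Steinberg relations over a commutative ring `S`, in the form that they take for a
simply-laced root system with structure constants `N`. -/
inductive SteinbergRel (S : Type*) [CommRing S] : FreeGroup (ι × S) → Prop
  | add (i : ι) (a b : S) :
      SteinbergRel S (of (i, a) * of (i, b) * (of (i, a + b))⁻¹)
  | comm_add (i j k : ι) (a b : S) (hk : P.root k = P.root i + P.root j) :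
      SteinbergRel S (⁅of (i, a), of (j, b)⁆ * (of (k, N i j • (a * b)))⁻¹)
  | comm_one (i j : ι) (a b : S) (h0 : P.root i + P.root j ≠ 0)
      (h : P.root i + P.root j ∉ Set.range P.root) :
      SteinbergRel S ⁅of (i, a), of (j, b)⁆

/-- The Steinberg group `St(P, S)` of a simply-laced root system. -/
abbrev Steinberg (S : Type*) [CommRing S] : Type _ :=
  PresentedGroup {r : FreeGroup (ι × S) | SteinbergRel P N S r}

/-- The generator `x_i(a)` of the Steinberg group. -/
def Steinberg.x {S : Type*} [CommRing S] (i : ι) (a : S) : Steinberg P N S :=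
  PresentedGroup.of (i, a)

variable {A : Type*} [CommRing A] (M : Ideal A)

open FreeGroup in
/-- The Steinberg relations of degree at most `n` between homogeneous generators of degree at
most `n`. The degree of a relation is the maximum of the degrees of the generators in it. -/
inductive TruncRel (n : ℤ) : FreeGroup (ι × HomCoeff M n) → Prop
  | add (i : ι) (d : ℤ) (hd : d ≤ n) (a b c : HomCoeff M n)
      (ha : a.1 ∈ homB M d) (hb : b.1 ∈ homB M d) (hc : c.1 = a.1 + b.1) :
      TruncRel n (of (i, a) * of (i, b) * (of (i, c))⁻¹)
  | comm_add (i j k : ι) (hk : P.root k = P.root i + P.root j)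
      (d e : ℤ) (hd : d ≤ n) (he : e ≤ n) (hde : d + e ≤ n) (a b c : HomCoeff M n)
      (ha : a.1 ∈ homB M d) (hb : b.1 ∈ homB M e) (hc : c.1 = N i j • (a.1 * b.1)) :
      TruncRel n (⁅of (i, a), of (j, b)⁆ * (of (k, c))⁻¹)
  | comm_acute (i j : ι) (h : P.root i - P.root j ∈ Set.range P.root)
      (d e : ℤ) (hd : d ≤ n) (he : e ≤ n) (a b : HomCoeff M n)
      (ha : a.1 ∈ homB M d) (hb : b.1 ∈ homB M e) :
      TruncRel n ⁅of (i, a), of (j, b)⁆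
  | comm_orthogonal (i j : ι) (h : P.IsOrthogonal i j)
      (d e : ℤ) (hd : d ≤ n) (he : e ≤ n) (a b : HomCoeff M n)
      (ha : a.1 ∈ homB M d) (hb : b.1 ∈ homB M e) :
      TruncRel n ⁅of (i, a), of (j, b)⁆

/-- The truncated Steinberg group `St^{≤ n}(P, B)`. -/
abbrev TruncSteinberg (n : ℤ) : Type _ :=
  PresentedGroup {r : FreeGroup (ι × HomCoeff M n) | TruncRel P N M n r}

/-- The generator `x_i(a)` of the truncated Steinberg group. -/
def TruncSteinberg.x {n : ℤ} (i : ι) (a : HomCoeff M n) : TruncSteinberg P N M n :=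
  PresentedGroup.of (i, a)

variable {M} in
/-- A homogeneous element of degree at most `n`, seen as one of degree at most `n + 1`. -/
def HomCoeff.succ {n : ℤ} (a : HomCoeff M n) : HomCoeff M (n + 1) :=
  ⟨a.1, a.2.imp fun _ hd => ⟨by omega, hd.2⟩⟩

theorem TruncRel.lift_eq_one {n : ℤ} {r : FreeGroup (ι × HomCoeff M n)}
    (hr : TruncRel P N M n r) :
    FreeGroup.lift (fun g : ι × HomCoeff M n => TruncSteinberg.x P N M g.1 g.2.succ) r = 1 := by
  have key : ∀ {s : FreeGroup (ι × HomCoeff M (n + 1))}, TruncRel P N M (n + 1) s →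
      (PresentedGroup.mk {r | TruncRel P N M (n + 1) r} s) = 1 := fun hs =>
    (QuotientGroup.eq_one_iff _).2 (Subgroup.subset_normalClosure hs)
  cases hr with
  | add i d hd a b c ha hb hc =>
    simpa [TruncSteinberg.x, PresentedGroup.of] using key (.add i d (by omega) a.succ b.succ c.succ ha hb hc)
  | comm_add i j k hk d e hd he hde a b c ha hb hc =>
    simpa [TruncSteinberg.x, PresentedGroup.of] using key (.comm_add i j k hk d e (by omega) (by omega) (by omega)
      a.succ b.succ c.succ ha hb hc)
  | comm_acute i j h d e hd he a b ha hb =>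
    simpa [TruncSteinberg.x, PresentedGroup.of] using key (.comm_acute i j h d e (by omega) (by omega) a.succ b.succ ha hb)
  | comm_orthogonal i j h d e hd he a b ha hb =>
    simpa [TruncSteinberg.x, PresentedGroup.of] using key (.comm_orthogonal i j h d e (by omega) (by omega) a.succ b.succ ha hb)

/-- The homomorphism `i_n : St^{≤ n}(P, B) → St^{≤ n+1}(P, B)` induced by the inclusion of the
generators, `x_i(a) ↦ x_i(a)`. -/
def TruncSteinberg.incl (n : ℤ) : TruncSteinberg P N M n →* TruncSteinberg P N M (n + 1) :=
  PresentedGroup.toGroup (f := fun g : ι × HomCoeff M n => TruncSteinberg.x P N M g.1 g.2.succ)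
    fun _ hr => TruncRel.lift_eq_one P N M hr

end Groups

end GradedSteinberg

/-!
A family `x_α(a)` of level `n` extends to degree `n + 1` in only one way. Multiplication by `t`
maps `B_d` onto `B_{d+1}` for `d ≥ 0`, so every element of degree `n + 1` is a product `ab` with
`a`, `b` of degrees between `1` and `n`, and for a decomposition `α = β + γ` into roots `x_α(±ab)`
has to be the commutator of `x_β(a)` and `x_γ(b)`. That this value does not depend on `β`, `γ`,
`a`, `b`, and that the new elements satisfy the relations, follows from Hall–Witt type identities
which move a summand from one root of a decomposition to the other. These need auxiliary roots,
which the root systems `A_l` (`l ≥ 4`), `D_l` (`l ≥ 5`) and `E_l` are large enough to supply. By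
iteration a family of level `n` extends to all degrees, and then additively to the whole ring;
applied to the generators of the truncated groups this inverts the homomorphisms in question.
-/

namespace GradedSteinberg

section SimplyLaced

variable {ι K V W : Type*} [Field K] [AddCommGroup V] [Module K V]
  [AddCommGroup W] [Module K W] (P : RootPairing ι K V W)

/-- The `k`-th root is the sum of the `i`-th root and the `j`-th root. -/
def IsSum (i j k : ι) : Prop :=
  P.root k = P.root i + P.root j

variable {P} in
theorem IsSum.symm {i j k : ι} (h : IsSum P i j k) : IsSum P j i k :=
  Eq.trans h (add_comm _ _)

theorem root_reflectionPerm_self (i : ι) : P.root (P.reflectionPerm i i) = -P.root i := by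
  simp [P.root_reflectionPerm]

variable [P.IsCrystallographic]

local notation "⟪" i "," j "⟫" => RootPairing.pairingIn P ℤ i j

theorem root_reflectionPerm_eq_sub_smul (i j : ι) :
    P.root (P.reflectionPerm i j) = P.root j - ⟪j,i⟫ • P.root i := by
  rw [P.root_reflectionPerm, P.reflection_apply_root, ← P.algebraMap_pairingIn ℤ,
    algebraMap_int_eq, eq_intCast, Int.cast_smul_eq_zsmul]

variable {P} in
theorem isSum_reflectionPerm {i j : ι} (h : ⟪i,j⟫ = -1) : IsSum P i j (P.reflectionPerm j i) := by
  rw [IsSum, root_reflectionPerm_eq_sub_smul, h, neg_one_zsmul, sub_neg_eq_add]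

variable {P} in
theorem exists_isSum {i j : ι} (h : ⟪i,j⟫ = -1) : ∃ k, IsSum P i j k :=
  ⟨_, isSum_reflectionPerm h⟩

variable {P} in
theorem exists_isSum_of_pairingIn_eq_one {i j : ι} (h : ⟪i,j⟫ = 1) : ∃ k, IsSum P j k i :=
  ⟨P.reflectionPerm j i, by
    rw [IsSum, root_reflectionPerm_eq_sub_smul, h, one_zsmul, add_sub_cancel]⟩

/-- A crystallographic root pairing is simply laced if its pairing of roots with coroots is
symmetric and takes values at most `1` on distinct roots. Finiteness is not part of the notion. -/
class IsSimplyLaced : Prop where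
  pairingIn_comm (i j : ι) : ⟪i,j⟫ = ⟪j,i⟫
  pairingIn_le_one {i j : ι} (h : i ≠ j) : ⟪i,j⟫ ≤ 1

theorem pairingIn_comm [IsSimplyLaced P] (i j : ι) : ⟪i,j⟫ = ⟪j,i⟫ :=
  IsSimplyLaced.pairingIn_comm i j

variable {P} in
theorem eq_of_pairingIn_eq_two [IsSimplyLaced P] {i j : ι} (h : ⟪i,j⟫ = 2) : i = j := by
  by_contra hij
  have := IsSimplyLaced.pairingIn_le_one (P := P) hij
  omega

variable [CharZero K]

theorem isSimplyLaced_of_pairingIn_comm [Finite ι] [P.IsReduced]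
    (h : ∀ i j, ⟪i,j⟫ = ⟪j,i⟫) : IsSimplyLaced P where
  pairingIn_comm := h
  pairingIn_le_one {i j} hij := by
    have hmem := P.pairingIn_pairingIn_mem_set_of_isCrystal_of_isRed i j
    have hne : ¬ (⟪i,j⟫ = 2 ∧ ⟪j,i⟫ = 2) := fun h2 => hij ((P.pairingIn_two_two_iff ℤ i j).1 h2)
    have := h i j
    simp only [Set.mem_insert_iff, Prod.mk.injEq, Set.mem_singleton_iff] at hmem
    omega

variable {P}

theorem isOrthogonal_iff_pairingIn_eq_zero {i j : ι} : P.IsOrthogonal i j ↔ ⟪i,j⟫ = 0 := by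
  rw [P.isOrthogonal_iff_pairing_eq_zero, ← P.algebraMap_pairingIn ℤ]
  simp

theorem pairingIn_reflectionPerm_left (i j k : ι) :
    ⟪P.reflectionPerm i j,k⟫ = ⟪j,k⟫ - ⟪j,i⟫ * ⟪i,k⟫ := by
  have hroot : P.root (P.reflectionPerm i j) = (1 : ℤ) • P.root j + (-⟪j,i⟫) • P.root i := by
    rw [root_reflectionPerm_eq_sub_smul, one_zsmul, neg_zsmul, sub_eq_add_neg]
  rw [P.pairingIn_eq_add_of_root_eq_smul_add_smul hroot, smul_eq_mul, smul_eq_mul]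
  ring

theorem IsSum.pairingIn_left {i j k : ι} (h : IsSum P i j k) (m : ι) :
    ⟪k,m⟫ = ⟪i,m⟫ + ⟪j,m⟫ :=
  P.pairingIn_eq_add_of_root_eq_add h

variable [IsSimplyLaced P]

theorem IsSum.pairingIn_right {i j k : ι} (h : IsSum P i j k) (m : ι) :
    ⟪m,k⟫ = ⟪m,i⟫ + ⟪m,j⟫ := by
  simp only [pairingIn_comm P m, h.pairingIn_left]

theorem IsSum.pairingIn_eq {i j k : ι} (h : IsSum P i j k) :
    ⟪i,j⟫ = -1 ∧ ⟪i,k⟫ = 1 ∧ ⟪j,k⟫ = 1 := by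
  have hi := h.pairingIn_right i
  have hj := h.pairingIn_right j
  have hk := h.pairingIn_right k
  have hij := pairingIn_comm P i j
  have hik := pairingIn_comm P i k
  have hjk := pairingIn_comm P j k
  rw [P.pairingIn_same] at hi hj hk
  omega

theorem eq_or_eq_reflectionPerm_self_or (i j : ι) :
    i = j ∨ i = P.reflectionPerm j j ∨ ⟪i,j⟫ = 1 ∨ ⟪i,j⟫ = 0 ∨ ⟪i,j⟫ = -1 := by
  by_cases h : i = j
  · exact .inl h
  by_cases h' : i = P.reflectionPerm j j
  · exact .inr (.inl h')
  have h1 := IsSimplyLaced.pairingIn_le_one (P := P) h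
  have h2 := IsSimplyLaced.pairingIn_le_one (P := P) h'
  rw [P.pairingIn_reflectionPerm_self_right] at h2
  omega

theorem isSum_of_pairingIn_eq {i j k : ι} (hij : ⟪i,j⟫ = -1) (hik : ⟪i,k⟫ = 1)
    (hjk : ⟪j,k⟫ = 1) : IsSum P i j k := by
  obtain ⟨m, hm⟩ := exists_isSum hij
  obtain rfl : m = k := eq_of_pairingIn_eq_two (P := P) (by rw [hm.pairingIn_left]; omega)
  exact hm

theorem pairingIn_mem_of_pairingIn_eq_zero {i j k : ι} (hij : ⟪i,j⟫ = 0) (hk : ⟪k,i⟫ ≠ 0) :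
    ⟪k,j⟫ = 1 ∨ ⟪k,j⟫ = 0 ∨ ⟪k,j⟫ = -1 := by
  have hji := pairingIn_comm P i j
  rcases eq_or_eq_reflectionPerm_self_or (P := P) k j with rfl | rfl | h
  · omega
  · rw [P.pairingIn_reflectionPerm_self_left] at hk
    omega
  · exact h

end SimplyLaced

section Ample

open Submodule

variable {ι K V W : Type*} [Field K] [CharZero K] [AddCommGroup V] [Module K V]
  [AddCommGroup W] [Module K W] (P : RootPairing ι K V W) [P.IsCrystallographic]

local notation "⟪" i "," j "⟫" => RootPairing.pairingIn P ℤ i j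

/-- The supply of auxiliary roots that the computations in truncated Steinberg groups need. It is
available in the irreducible simply-laced root systems of rank at least `4` other than `D₄`. -/
class IsAmple : Prop where
  exists_acute (α : ι) : ∃ β, ⟪β,α⟫ = 1
  exists_acute_obtuse {α ρ : ι} (h : ⟪α,ρ⟫ = 0) : ∃ σ, ⟪σ,α⟫ = 1 ∧ ⟪σ,ρ⟫ = -1
  exists_orthogonal {α β : ι} (h : ⟪β,α⟫ = 1) :
    ∃ ρ, ⟪ρ,α⟫ = 0 ∧ ⟪ρ,β⟫ = 1 ∧ ∃ σ, ⟪σ,α⟫ = 1 ∧ ⟪σ,ρ⟫ = 0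

/-- `ρ` is a twin of `α` if it is orthogonal to `α` but to no root forming an acute angle with `α`,
as the roots `ε₁ + ε₂` and `ε₁ - ε₂` of `D_l`. Twins are what `IsAmple.exists_orthogonal` has to
avoid. -/
def IsTwin (α ρ : ι) : Prop :=
  ⟪α,ρ⟫ = 0 ∧ ∀ σ, ⟪σ,α⟫ = 1 → ⟪σ,ρ⟫ ≠ 0

/-- The roots that are orthogonal to `α` and form an acute angle with `β`. -/
def link (α β : ι) : Set ι :=
  {ρ | ⟪α,ρ⟫ = 0 ∧ ⟪ρ,β⟫ = 1}

variable {P}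

omit [CharZero K] in
theorem root_reflectionPerm_mem_iff {U : Submodule K V} {α σ : ι} (hα : P.root α ∈ U) :
    P.root (P.reflectionPerm α σ) ∈ U ↔ P.root σ ∈ U := by
  rw [root_reflectionPerm_eq_sub_smul]
  exact sub_mem_iff_left _ (zsmul_mem hα _)

variable [IsSimplyLaced P] {α β ρ ρ' σ τ : ι}

namespace IsTwin

theorem odd_pairingIn (h : IsTwin P α ρ) (hσ : ⟪σ,α⟫ = 1) : Odd ⟪σ,ρ⟫ := by
  rcases pairingIn_mem_of_pairingIn_eq_zero (k := σ) h.1 (by omega) with h' | h' | h'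
  · simp [h']
  · exact absurd h' (h.2 σ hσ)
  · simp [h']

theorem even_pairingIn (h : IsTwin P α ρ) (hβ : ⟪β,α⟫ = 1) (hτ : ⟪τ,α⟫ = 0) : Even ⟪τ,ρ⟫ := by
  have hρ : ⟪ρ,α⟫ = 0 := (pairingIn_comm P ρ α).trans h.1
  have odd_β := h.odd_pairingIn hβ
  have odd_τ := h.odd_pairingIn (σ := P.reflectionPerm τ β)
    (by rw [pairingIn_reflectionPerm_left, hτ, hβ, mul_zero, sub_zero])
  have odd_ρτ := h.odd_pairingIn (σ := P.reflectionPerm τ (P.reflectionPerm ρ β))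
    (by simp only [pairingIn_reflectionPerm_left, hτ, hρ, hβ, mul_zero, sub_zero])
  simp only [pairingIn_reflectionPerm_left, pairingIn_comm P ρ τ, P.pairingIn_same] at odd_τ odd_ρτ
  grind [Int.odd_sub, Int.odd_mul]

theorem pairingIn_eq_zero_or (h : IsTwin P α ρ) (hβ : ⟪β,α⟫ = 1) (hτ : ⟪τ,α⟫ = 0) :
    ⟪τ,ρ⟫ = 0 ∨ τ = ρ ∨ τ = P.reflectionPerm ρ ρ := by
  have heven := h.even_pairingIn hβ hτ
  rw [Int.even_iff] at heven
  rcases eq_or_eq_reflectionPerm_self_or (P := P) τ ρ with h' | h' | h' <;> grind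

theorem even_pairingIn_add (h : IsTwin P α ρ) (hβ : ⟪β,α⟫ = 1) (σ : ι) :
    Even (⟪σ,α⟫ + ⟪σ,ρ⟫) := by
  have odd_neg (hσ : ⟪σ,α⟫ = -1) : Odd ⟪σ,ρ⟫ := by
    have := h.odd_pairingIn (σ := P.reflectionPerm σ σ) (by simp [hσ])
    simpa using this
  rcases eq_or_eq_reflectionPerm_self_or (P := P) σ α with rfl | rfl | hσ | hσ | hσ
  · simp [h.1]
  · simp [h.1]
  · exact (hσ ▸ odd_one).add_odd (h.odd_pairingIn hσ)
  · exact (hσ ▸ Even.zero).add (h.even_pairingIn hβ hσ)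
  · exact (hσ ▸ odd_neg_one).add_odd (odd_neg hσ)

end IsTwin

theorem root_mem_span_of_orthogonal (hα : ⟪σ,α⟫ = 0) (hβ : ⟪σ,β⟫ ≠ 0) :
    P.root σ ∈ span K (P.root '' ({α, β} ∪ link P α β)) := by
  have mem_of_link {ρ} (hρ : ρ ∈ link P α β) :
      P.root ρ ∈ span K (P.root '' ({α, β} ∪ link P α β)) := subset_span ⟨ρ, .inr hρ, rfl⟩
  have hβ_mem : P.root β ∈ span K (P.root '' ({α, β} ∪ link P α β)) := subset_span ⟨β, by simp⟩
  rw [pairingIn_comm] at hα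
  rcases eq_or_eq_reflectionPerm_self_or (P := P) σ β with rfl | rfl | h | h | h
  · exact hβ_mem
  · exact (root_reflectionPerm_mem_iff hβ_mem).2 hβ_mem
  · exact mem_of_link ⟨hα, h⟩
  · exact absurd h hβ
  · rw [← neg_mem_iff, ← root_reflectionPerm_self]
    exact mem_of_link ⟨by simp [hα], by simp [h]⟩

theorem root_mem_span_of_pairingIn_ne_zero (hβ : ⟪β,α⟫ = 1) (hσ : ⟪σ,α⟫ ≠ 0 ∨ ⟪σ,β⟫ ≠ 0) :
    P.root σ ∈ span K (P.root '' ({α, β} ∪ link P α β)) := by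
  set U := span K (P.root '' ({α, β} ∪ link P α β))
  have hα_mem : P.root α ∈ U := subset_span ⟨α, by simp⟩
  have hβ_mem : P.root β ∈ U := subset_span ⟨β, by simp⟩
  have mem_of_eq_neg {i} (hi : P.root i ∈ U) : P.root (P.reflectionPerm i i) ∈ U :=
    (root_reflectionPerm_mem_iff hi).2 hi
  have hαβ : ⟪α,β⟫ = 1 := (pairingIn_comm P α β).trans hβ
  rcases eq_or_eq_reflectionPerm_self_or (P := P) σ α with rfl | rfl | ha
  · exact hα_mem
  · exact mem_of_eq_neg hα_mem
  rcases eq_or_eq_reflectionPerm_self_or (P := P) σ β with rfl | rfl | hb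
  · exact hβ_mem
  · exact mem_of_eq_neg hβ_mem
  have mem_of_eq {τ} (h : ⟪τ,α⟫ = ⟪τ,β⟫) (h0 : ⟪τ,β⟫ ≠ 0) : P.root τ ∈ U := by
    rw [← root_reflectionPerm_mem_iff hβ_mem]
    refine root_mem_span_of_orthogonal ?_ ?_ <;>
      rw [pairingIn_reflectionPerm_left] <;> simp only [hβ, P.pairingIn_same] <;> omega
  rcases eq_or_eq_reflectionPerm_self_or (P := P) (P.reflectionPerm β σ) α with h | h | h
  · rw [← root_reflectionPerm_mem_iff hβ_mem, h]
    exact hα_mem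
  · rw [← root_reflectionPerm_mem_iff hβ_mem, h]
    exact mem_of_eq_neg hα_mem
  rw [pairingIn_reflectionPerm_left, hβ, mul_one] at h
  obtain h0 | h0 | h0 : ⟪σ,α⟫ = 0 ∨ ⟪σ,α⟫ = ⟪σ,β⟫ ∨ ⟪σ,β⟫ = 0 := by omega
  · exact root_mem_span_of_orthogonal h0 (by simpa [h0] using hσ)
  · exact mem_of_eq h0 (h0 ▸ by simpa [← h0] using hσ)
  · rw [← root_reflectionPerm_mem_iff hα_mem]
    apply mem_of_eq <;> simp only [pairingIn_reflectionPerm_left, hαβ, P.pairingIn_same, h0] <;>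
      omega

theorem span_link_eq_top_of_forall_isTwin [P.IsIrreducible] (hβ : ⟪β,α⟫ = 1)
    (h : ∀ ρ ∈ link P α β, IsTwin P α ρ) :
    span K (P.root '' ({α, β} ∪ link P α β)) = ⊤ := by
  refine P.span_root_image_eq_top_of_forall_orthogonal _ ⟨α, by simp⟩ fun σ hσ ρ hρ => ?_
  rw [isOrthogonal_iff_pairingIn_eq_zero]
  obtain ⟨hσα, hσβ⟩ : ⟪σ,α⟫ = 0 ∧ ⟪σ,β⟫ = 0 := by
    by_contra! h0
    exact hσ (root_mem_span_of_pairingIn_ne_zero hβ (by tauto))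
  rcases hρ with (rfl | rfl) | hρ
  · exact hσα
  · exact hσβ
  have hρ_mem := subset_span (R := K) (Set.mem_image_of_mem P.root (Set.mem_union_right {α, β} hρ))
  rcases (h ρ hρ).pairingIn_eq_zero_or hβ hσα with h0 | rfl | rfl
  · exact h0
  · exact absurd hρ_mem hσ
  · exact absurd ((root_reflectionPerm_mem_iff hρ_mem).2 hρ_mem) hσ

theorem IsTwin.pairingIn_link_eq_zero (h : IsTwin P α ρ) (hβ : ⟪β,α⟫ = 1) (hρ : ρ ∈ link P α β)
    (hρ' : ρ' ∈ link P α β) (hne : ρ' ≠ ρ) : ⟪ρ',ρ⟫ = 0 := by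
  rcases h.pairingIn_eq_zero_or hβ ((pairingIn_comm P ρ' α).trans hρ'.1) with h0 | h0 | rfl
  · exact h0
  · exact absurd h0 hne
  · have := hρ.2
    have := hρ'.2
    rw [P.pairingIn_reflectionPerm_self_left] at this
    omega

theorem root_eq_two_nsmul_sub_of_mem_link {ρ₁ ρ₂ ρ₃ : ι} (hβ : ⟪β,α⟫ = 1)
    (h₁ : ρ₁ ∈ link P α β) (h₂ : ρ₂ ∈ link P α β) (h₃ : ρ₃ ∈ link P α β)
    (h₁₂ : ⟪ρ₁,ρ₂⟫ = 0) (h₁₃ : ⟪ρ₁,ρ₃⟫ = 0) (h₂₃ : ⟪ρ₂,ρ₃⟫ = 0) :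
    P.root α = 2 • P.root β - P.root ρ₁ - P.root ρ₂ - P.root ρ₃ := by
  have pairing_β {ρ} (hρ : ρ ∈ link P α β) : ⟪β,ρ⟫ = 1 := (pairingIn_comm P β ρ).trans hρ.2
  have pairing_α {ρ} (hρ : ρ ∈ link P α β) : ⟪ρ,α⟫ = 0 := (pairingIn_comm P ρ α).trans hρ.1
  set γ := P.reflectionPerm ρ₃ (P.reflectionPerm ρ₂ (P.reflectionPerm ρ₁ β)) with hγ
  have root_γ : P.root γ = P.root β - P.root ρ₁ - P.root ρ₂ - P.root ρ₃ := by
    simp only [hγ, root_reflectionPerm_eq_sub_smul, pairingIn_reflectionPerm_left, pairing_β h₁,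
      pairing_β h₂, pairing_β h₃, h₁₂, h₁₃, h₂₃, mul_zero, sub_zero, one_zsmul]
  have γα : ⟪γ,α⟫ = 1 := by
    simp [hγ, pairingIn_reflectionPerm_left, pairing_α h₁, pairing_α h₂, pairing_α h₃, hβ]
  have γβ : ⟪γ,β⟫ = -1 := by
    simp [hγ, pairingIn_reflectionPerm_left, pairing_β h₁, pairing_β h₂, pairing_β h₃,
      h₁.2, h₂.2, h₃.2, h₁₂, h₁₃, h₂₃]
  have sum_eq : IsSum P γ β α := isSum_of_pairingIn_eq γβ γα hβ
  rw [sum_eq, root_γ]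
  abel

theorem exists_span_link_le_of_forall_isTwin (hβ : ⟪β,α⟫ = 1)
    (h : ∀ ρ ∈ link P α β, IsTwin P α ρ) : ∃ ρ₁ ρ₂, span K (P.root '' ({α, β} ∪ link P α β)) ≤
      span K (Set.range ![P.root α, P.root β, P.root ρ₁, P.root ρ₂]) := by
  have orth {ρ ρ'} (hρ : ρ ∈ link P α β) (hρ' : ρ' ∈ link P α β) (hne : ρ' ≠ ρ) :=
    (h ρ hρ).pairingIn_link_eq_zero hβ hρ hρ' hne
  suffices ∃ ρ₁ ρ₂, ∀ ρ ∈ link P α β,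
      P.root ρ ∈ span K (Set.range ![P.root α, P.root β, P.root ρ₁, P.root ρ₂]) by
    obtain ⟨ρ₁, ρ₂, hspan⟩ := this
    refine ⟨ρ₁, ρ₂, span_le.2 ?_⟩
    rintro _ ⟨ρ, (rfl | rfl) | hρ, rfl⟩
    · exact subset_span ⟨0, rfl⟩
    · exact subset_span ⟨1, rfl⟩
    · exact hspan ρ hρ
  by_cases hsub : (link P α β).Subsingleton
  · rcases hsub.eq_empty_or_singleton with h0 | ⟨ρ₁, h1⟩
    · exact ⟨α, α, by simp [h0]⟩
    · refine ⟨ρ₁, ρ₁, fun ρ hρ => subset_span ⟨2, ?_⟩⟩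
      rw [Set.mem_singleton_iff.1 (h1.subset hρ)]
      rfl
  obtain ⟨ρ₁, h₁, ρ₂, h₂, hne⟩ := Set.not_subsingleton_iff.1 hsub
  refine ⟨ρ₁, ρ₂, fun ρ hρ => ?_⟩
  by_cases hρ₁ : ρ = ρ₁
  · exact subset_span ⟨2, by rw [hρ₁]; rfl⟩
  by_cases hρ₂ : ρ = ρ₂
  · exact subset_span ⟨3, by rw [hρ₂]; rfl⟩
  have hα := root_eq_two_nsmul_sub_of_mem_link hβ h₁ h₂ hρ (orth h₂ h₁ hne)
    (orth hρ h₁ (Ne.symm hρ₁)) (orth hρ h₂ (Ne.symm hρ₂))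
  have hroot : P.root ρ = 2 • P.root β - P.root ρ₁ - P.root ρ₂ - P.root α := by
    rw [hα]
    module
  rw [hroot]
  have mem (i : Fin 4) : ![P.root α, P.root β, P.root ρ₁, P.root ρ₂] i ∈
      span K (Set.range ![P.root α, P.root β, P.root ρ₁, P.root ρ₂]) := subset_span ⟨i, rfl⟩
  exact sub_mem (sub_mem (sub_mem (nsmul_mem (mem 1) 2) (mem 2)) (mem 3)) (mem 0)

variable [P.IsIrreducible]

theorem exists_mem_link_not_isTwin_of_finrank (h : 5 ≤ Module.finrank K V) (hβ : ⟪β,α⟫ = 1) :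
    ∃ ρ ∈ link P α β, ¬ IsTwin P α ρ := by
  by_contra! htwin
  obtain ⟨ρ₁, ρ₂, hle⟩ := exists_span_link_le_of_forall_isTwin hβ htwin
  rw [span_link_eq_top_of_forall_isTwin hβ htwin, top_le_iff] at hle
  have := finrank_le_of_span_eq_top hle
  rw [Fintype.card_fin] at this
  omega

theorem nonempty_link_of_finrank (h : 3 ≤ Module.finrank K V) (hβ : ⟪β,α⟫ = 1) :
    (link P α β).Nonempty := by
  by_contra hempty
  rw [Set.not_nonempty_iff_eq_empty] at hempty
  have htop := span_link_eq_top_of_forall_isTwin hβ (by simp [hempty])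
  rw [hempty, Set.union_empty, Set.image_pair, ← Matrix.range_cons_cons_empty _ _ ![]] at htop
  have := finrank_le_of_span_eq_top htop
  rw [Fintype.card_fin] at this
  omega

theorem exists_pairingIn_eq_one (h : 2 ≤ Module.finrank K V) (α : ι) : ∃ β, ⟪β,α⟫ = 1 := by
  by_contra! hno
  have htop : span K (P.root '' {α}) = ⊤ := by
    refine P.span_root_image_eq_top_of_forall_orthogonal _ (Set.singleton_nonempty α) fun σ hσ => ?_
    have hα : P.root α ∈ span K (P.root '' {α}) := subset_span ⟨α, rfl, rfl⟩
    have hσ_neg := hno (P.reflectionPerm σ σ)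
    rw [P.pairingIn_reflectionPerm_self_left] at hσ_neg
    rintro τ (hτ : τ = α)
    rw [hτ, isOrthogonal_iff_pairingIn_eq_zero]
    rcases eq_or_eq_reflectionPerm_self_or (P := P) σ α with rfl | rfl | h1 | h0 | h1
    · exact absurd hα hσ
    · exact absurd ((root_reflectionPerm_mem_iff hα).2 hα) hσ
    · exact absurd h1 (hno σ)
    · exact h0
    · omega
  rw [Set.image_singleton, ← Matrix.range_cons_empty _ ![]] at htop
  have := finrank_le_of_span_eq_top htop
  rw [Fintype.card_fin] at this
  omega

theorem exists_pairingIn_ne_zero_and_ne_zero (α ρ : ι) : ∃ σ, ⟪σ,α⟫ ≠ 0 ∧ ⟪σ,ρ⟫ ≠ 0 := by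
  by_contra! hno
  set s : Set ι := {σ | ⟪σ,α⟫ ≠ 0}
  have htop : span K (P.root '' s) = ⊤ := by
    refine P.span_root_image_eq_top_of_forall_orthogonal _ ⟨α, by simp [s]⟩ fun σ hσ τ hτ => ?_
    rw [isOrthogonal_iff_pairingIn_eq_zero, pairingIn_comm]
    by_contra hτσ
    have mem_span {i} (hi : i ∈ s) : P.root i ∈ span K (P.root '' s) := subset_span ⟨i, hi, rfl⟩
    have hσα : ⟪σ,α⟫ = 0 := by
      by_contra h0
      exact hσ (mem_span h0)
    refine hσ ((root_reflectionPerm_mem_iff (mem_span hτ)).1 (mem_span ?_))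
    change ⟪P.reflectionPerm τ σ,α⟫ ≠ 0
    rw [pairingIn_reflectionPerm_left, hσα, zero_sub, pairingIn_comm P σ τ]
    exact neg_ne_zero.2 (mul_ne_zero hτσ hτ)
  have hle : span K (P.root '' s) ≤ LinearMap.ker (P.coroot' ρ) := by
    rw [span_le]
    rintro _ ⟨σ, hσ, rfl⟩
    simpa [← P.algebraMap_pairingIn ℤ] using hno σ hσ
  have hρ : P.root ρ ∈ LinearMap.ker (P.coroot' ρ) := hle (htop ▸ mem_top)
  simp at hρ

theorem exists_pairingIn_eq_one_and_eq_neg_one {ρ : ι} (hαρ : ⟪α,ρ⟫ = 0) :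
    ∃ σ, ⟪σ,α⟫ = 1 ∧ ⟪σ,ρ⟫ = -1 := by
  have hρα : ⟪ρ,α⟫ = 0 := (pairingIn_comm P ρ α).trans hαρ
  obtain ⟨σ, hσα, hσρ⟩ := exists_pairingIn_ne_zero_and_ne_zero (P := P) α ρ
  obtain ⟨τ, hτα, hτρ⟩ : ∃ τ, ⟪τ,α⟫ = 1 ∧ ⟪τ,ρ⟫ ≠ 0 := by
    rcases pairingIn_mem_of_pairingIn_eq_zero hρα hσρ with h | h | h
    · exact ⟨σ, h, hσρ⟩
    · exact absurd h hσα
    · exact ⟨P.reflectionPerm α σ, by simp [pairingIn_reflectionPerm_left, h],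
        by simpa [pairingIn_reflectionPerm_left, hαρ]⟩
  rcases pairingIn_mem_of_pairingIn_eq_zero (k := τ) hαρ (by omega) with h | h | h
  · exact ⟨P.reflectionPerm ρ τ, by simp [pairingIn_reflectionPerm_left, hρα, hτα],
      by simp [pairingIn_reflectionPerm_left, h]⟩
  · exact absurd h hτρ
  · exact ⟨τ, hτα, h⟩

end Ample

section ConnectedMatrix

/-- The graph on the indices of the square matrix `C` whose edges are the non-zero entries of `C` is
connected. For a Cartan matrix this is the Dynkin diagram. -/
def IsConnectedMatrix {n : Type*} (C : Matrix n n ℤ) : Prop :=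
  ∀ S : Set n, S.Nonempty → (∀ i ∈ S, ∀ j, C i j ≠ 0 → j ∈ S) → S = Set.univ

theorem isConnectedMatrix_of_parent {n : Type*} {C : Matrix n n ℤ} (hC : C.IsSymm) (r : n)
    (parent : n → n) (height : n → ℕ)
    (h : ∀ i, i ≠ r → height (parent i) < height i ∧ C i (parent i) ≠ 0) :
    IsConnectedMatrix C := by
  rintro S ⟨i, hi⟩ hS
  have root_mem : r ∈ S := by
    induction hn : height i using Nat.strong_induction_on generalizing i with
    | _ n ih =>
      by_cases hir : i = r
      · exact hir ▸ hi
      obtain ⟨hlt, hne⟩ := h i hir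
      exact ih _ (hn ▸ hlt) _ (hS i hi _ hne) rfl
  refine Set.eq_univ_of_forall fun i => ?_
  induction hn : height i using Nat.strong_induction_on generalizing i with
  | _ n ih =>
    by_cases hir : i = r
    · exact hir ▸ root_mem
    obtain ⟨hlt, hne⟩ := h i hir
    exact hS _ (ih _ (hn ▸ hlt) _ rfl) i (hC.apply i _ ▸ hne)

theorem isConnectedMatrix_A (l : ℕ) [NeZero l] : IsConnectedMatrix (CartanMatrix.A l) := by
  refine isConnectedMatrix_of_parent (CartanMatrix.A_isSymm l) 0
    (fun i => ⟨i.val - 1, by omega⟩) Fin.val fun i hi => ?_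
  have hi0 : i.val ≠ 0 := mt Fin.val_eq_zero_iff.1 hi
  refine ⟨by simp only; omega, ?_⟩
  simp only [CartanMatrix.A, Matrix.of_apply]
  grind

theorem isConnectedMatrix_D {l : ℕ} (hl : 3 ≤ l) : IsConnectedMatrix (CartanMatrix.D l) := by
  have : NeZero l := ⟨by omega⟩
  refine isConnectedMatrix_of_parent (CartanMatrix.D_isSymm l) 0
    (fun i => ⟨if i.val + 1 = l then l - 3 else i.val - 1, by split_ifs <;> omega⟩) Fin.val
    fun i hi => ?_
  have hi0 : i.val ≠ 0 := mt Fin.val_eq_zero_iff.1 hi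
  refine ⟨by simp only; split_ifs <;> omega, ?_⟩
  simp only [CartanMatrix.D, Matrix.of_apply]
  grind

theorem isConnectedMatrix_E₆ : IsConnectedMatrix CartanMatrix.E₆ :=
  isConnectedMatrix_of_parent CartanMatrix.E₆_isSymm 5 ![2, 3, 3, 4, 5, 5]
    (fun i => 5 - i.val) (by decide)

theorem isConnectedMatrix_E₇ : IsConnectedMatrix CartanMatrix.E₇ :=
  isConnectedMatrix_of_parent CartanMatrix.E₇_isSymm 6 ![2, 3, 3, 4, 5, 6, 6]
    (fun i => 6 - i.val) (by decide)

theorem isConnectedMatrix_E₈ : IsConnectedMatrix CartanMatrix.E₈ :=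
  isConnectedMatrix_of_parent CartanMatrix.E₈_isSymm 7 ![2, 3, 3, 4, 5, 6, 7, 7]
    (fun i => 7 - i.val) (by decide)

end ConnectedMatrix

section EvenMatrix

open Matrix

variable {n : Type*} [Fintype n] {C : Matrix n n ℤ}

theorem even_dotProduct_mulVec (hC : C.IsSymm) (hdiag : ∀ i, Even (C i i)) (v : n → ℤ) :
    Even (v ⬝ᵥ C *ᵥ v) := by
  classical
  simp only [dotProduct, mulVec, Finset.mul_sum, ← Finset.sum_product',
    ← ZMod.intCast_eq_zero_iff_even,
    Int.cast_sum]
  refine Finset.sum_involution (fun x _ => x.swap) (fun x _ => ?_) (fun x _ hx => ?_)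
    (fun _ _ => by simp) fun _ _ => Prod.swap_swap _
  · rw [Prod.fst_swap, Prod.snd_swap, hC.apply x.1 x.2, ← Int.cast_add,
      ZMod.intCast_eq_zero_iff_even]
    exact ⟨v x.1 * (C x.1 x.2 * v x.2), by ring⟩
  · rintro heq
    rw [Ne, ZMod.intCast_eq_zero_iff_even] at hx
    have : x.2 = x.1 := congrArg Prod.fst heq
    rw [this] at hx
    exact hx (((hdiag x.1).mul_right _).mul_left _)

theorem exists_eq_two_nsmul_of_odd_det [DecidableEq n] (hdet : Odd C.det) {v : n → ℤ}
    (h : ∀ i, Even ((C *ᵥ v) i)) : ∃ w : n → ℤ, v = 2 • w := by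
  have hcast : (C.map (Int.castRingHom (ZMod 2))) *ᵥ (Int.castRingHom (ZMod 2) ∘ v) = 0 := by
    ext i
    rw [← RingHom.map_mulVec]
    exact (ZMod.intCast_eq_zero_iff_even).2 (h i)
  have hdet' : (C.map (Int.castRingHom (ZMod 2))).det ≠ 0 := by
    rw [← RingHom.mapMatrix_apply, ← RingHom.map_det]
    exact fun h0 => Int.not_even_iff_odd.2 hdet (ZMod.intCast_eq_zero_iff_even.1 h0)
  have hv (i : n) : Even (v i) :=
    ZMod.intCast_eq_zero_iff_even.1 (congrFun (eq_zero_of_mulVec_eq_zero hdet' hcast) i)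
  choose w hw using fun i => (hv i).two_dvd
  exact ⟨w, funext fun i => by simpa using hw i⟩

end EvenMatrix

section TypeADE

open Submodule Matrix

variable {ι K V W : Type*} [Field K] [CharZero K] [AddCommGroup V] [Module K V]
  [AddCommGroup W] [Module K W] {P : RootPairing ι K V W} [P.IsCrystallographic]
  {l : ℕ} {C : Matrix (Fin l) (Fin l) ℤ}

local notation "⟪" i "," j "⟫" => RootPairing.pairingIn P ℤ i j

theorem pairingIn_eq_dotProduct {n : Type*} [Fintype n] {r : n → ι} {f : n → ℤ} {i : ι}
    (h : P.root i = ∑ k, f k • P.root (r k)) (j : ι) : ⟪i,j⟫ = f ⬝ᵥ fun k => ⟪r k,j⟫ := by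
  apply (algebraMap ℤ K).injective_int
  simp only [dotProduct, map_sum, map_mul, P.algebraMap_pairingIn, ← P.root_coroot'_eq_pairing, h]
  simp

namespace HasCartanMatrix

omit [CharZero K] in
theorem finrank_eq [P.IsRootSystem] (h : HasCartanMatrix P C) : Module.finrank K V = l := by
  obtain ⟨b, e, -⟩ := h
  rw [Module.finrank_eq_card_basis (b.toWeightBasis.reindex e), Fintype.card_fin]

theorem exists_simpleRoots (h : HasCartanMatrix P C) : ∃ r : Fin l → ι,
    (∀ k m, ⟪r k,r m⟫ = C k m) ∧ ∀ i, ∃ f : Fin l → ℤ, P.root i = ∑ k, f k • P.root (r k) := by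
  obtain ⟨b, e, he⟩ := h
  refine ⟨fun k => e.symm k, fun k m => ?_, fun i => ?_⟩
  · simpa [RootPairing.Base.cartanMatrixIn_def] using he (e.symm k) (e.symm m)
  · obtain ⟨f, -, -, hf⟩ := b.exists_root_eq_sum_int i
    refine ⟨fun k => f (e.symm k), ?_⟩
    rw [Equiv.sum_comp e.symm (fun x : b.support => f x • P.root x),
      ← b.support.sum_subtype (f := fun x => f x • P.root x) (by tauto), hf]

theorem form_root_root_eq [Finite ι] [P.IsReduced] (h : HasCartanMatrix P C) (hC : C.IsSymm)
    (hconn : IsConnectedMatrix C) (B : P.InvariantForm) (i j : ι) :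
    B.form (P.root i) (P.root i) = B.form (P.root j) (P.root j) := by
  obtain ⟨b, e, he⟩ := h
  have : Nonempty ι := ⟨i⟩
  obtain ⟨i₀, hi₀⟩ := b.support_nonempty
  have cartanMatrix_apply (k m : Fin l) : P.pairing (e.symm k) (e.symm m) = C k m := by
    have hkm := he (e.symm k) (e.symm m)
    simp only [RootPairing.Base.cartanMatrixIn_def, Equiv.apply_symm_apply] at hkm
    rw [← P.algebraMap_pairingIn ℤ, hkm, algebraMap_int_eq, eq_intCast]
  have simple (k : Fin l) : B.form (P.root (e.symm k)) (P.root (e.symm k)) =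
      B.form (P.root i₀) (P.root i₀) := by
    refine Set.eq_univ_iff_forall.1 (hconn {k | B.form (P.root (e.symm k)) (P.root (e.symm k)) =
      B.form (P.root i₀) (P.root i₀)} ⟨e ⟨i₀, hi₀⟩, by simp⟩ fun k hk m hkm => ?_) k
    have hswap := B.pairing_mul_eq_pairing_mul_swap (e.symm k) (e.symm m)
    rw [cartanMatrix_apply, cartanMatrix_apply, hC.apply] at hswap
    exact (mul_left_cancel₀ (Int.cast_ne_zero.2 hkm) hswap).symm.trans hk
  suffices ∀ k, B.form (P.root k) (P.root k) = B.form (P.root i₀) (P.root i₀) by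
    rw [this i, this j]
  intro k
  refine b.induction_reflect (p := fun k => B.form (P.root k) (P.root k) =
    B.form (P.root i₀) (P.root i₀)) k ?_ ?_ ?_
  · intro k hk
    simpa [P.root_reflectionPerm] using hk
  · intro k hk
    simpa using simple (e ⟨k, hk⟩)
  · intro k m hk _
    simpa [P.root_reflectionPerm] using hk

theorem isSimplyLaced [Finite ι] [P.IsReduced] (h : HasCartanMatrix P C) (hC : C.IsSymm)
    (hconn : IsConnectedMatrix C) : IsSimplyLaced P := by
  refine isSimplyLaced_of_pairingIn_comm P fun i j => ?_
  have : Fintype ι := Fintype.ofFinite ι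
  have hswap := P.toInvariantForm.pairing_mul_eq_pairing_mul_swap i j
  rw [h.form_root_root_eq hC hconn _ i j] at hswap
  have hpairing := mul_right_cancel₀ (P.toInvariantForm.ne_zero j) hswap
  rw [← P.algebraMap_pairingIn ℤ, ← P.algebraMap_pairingIn ℤ] at hpairing
  exact ((algebraMap ℤ K).injective_int hpairing).symm

theorem isIrreducible [P.IsRootSystem] [NeZero l] (h : HasCartanMatrix P C)
    (hconn : IsConnectedMatrix C) : P.IsIrreducible := by
  have hrank := h.finrank_eq
  obtain ⟨r, hr, hspan⟩ := h.exists_simpleRoots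
  have : Nontrivial V := Module.nontrivial_of_finrank_pos (R := K) (hrank ▸ NeZero.pos l)
  refine RootPairing.IsIrreducible.mk' P fun q hq hq0 =>
    P.eq_top_of_mem_invtSubmodule_of_forall_eq_univ q hq0 hq fun Φ ⟨i, hi⟩ hΦq hq_ker => ?_
  have pairingIn_eq_zero {j k} (hj : j ∈ Φ) (hk : k ∉ Φ) : ⟪j,k⟫ = 0 := by
    have := hq_ker k hk (hΦq ⟨j, hj, rfl⟩)
    simpa [← P.algebraMap_pairingIn ℤ] using this
  have root_mem {U : Submodule K V} (hU : ∀ k, P.root (r k) ∈ U) (j : ι) : P.root j ∈ U := by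
    obtain ⟨f, hf⟩ := hspan j
    exact hf ▸ sum_mem fun k _ => zsmul_mem (hU k) _
  have simple_nonempty : {k | r k ∈ Φ}.Nonempty := by
    by_contra hempty
    have mem_ker : P.root i ∈ LinearMap.ker (P.coroot' i) := by
      refine root_mem (fun k => ?_) i
      have := pairingIn_eq_zero hi fun hk => hempty ⟨k, hk⟩
      rw [P.pairingIn_eq_zero_iff] at this
      simp [← P.algebraMap_pairingIn ℤ, this]
    simp at mem_ker
  have simple_eq_univ : {k | r k ∈ Φ} = Set.univ := by
    refine hconn _ simple_nonempty fun k hk m hkm => ?_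
    by_contra hm
    exact hkm (hr k m ▸ pairingIn_eq_zero hk hm)
  refine Set.eq_univ_of_forall fun j => ?_
  by_contra hj
  have mem_ker := hq_ker j hj (root_mem (fun k => hΦq ⟨r k, simple_eq_univ.ge trivial, rfl⟩) j)
  simp at mem_ker

theorem not_isTwin_of_odd_det [IsSimplyLaced P] (h : HasCartanMatrix P C) (hdet : Odd C.det)
    {α β ρ : ι} (hβ : ⟪β,α⟫ = 1) : ¬ IsTwin P α ρ := by
  intro htwin
  obtain ⟨r, hr, hspan⟩ := h.exists_simpleRoots
  obtain ⟨f, hf⟩ := hspan α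
  obtain ⟨g, hg⟩ := hspan ρ
  have hC : C.IsSymm := Matrix.IsSymm.ext fun k m => by rw [← hr, ← hr, pairingIn_comm]
  have hdiag (k : Fin l) : Even (C k k) := by simp [← hr]
  have pairing_add (i : ι) : ⟪α,i⟫ + ⟪ρ,i⟫ = (f + g) ⬝ᵥ fun k => ⟪r k,i⟫ := by
    rw [add_dotProduct, pairingIn_eq_dotProduct hf, pairingIn_eq_dotProduct hg]
  have mulVec_eq : C *ᵥ (f + g) = fun k => ⟪r k,α⟫ + ⟪r k,ρ⟫ := by
    ext m
    rw [pairingIn_comm P _ α, pairingIn_comm P _ ρ, pairing_add, dotProduct_comm]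
    simp only [hr, mulVec, hC.apply]
  have norm_eq : (f + g) ⬝ᵥ C *ᵥ (f + g) = 4 := by
    rw [mulVec_eq]
    change (f + g) ⬝ᵥ ((fun k => ⟪r k,α⟫) + fun k => ⟪r k,ρ⟫) = 4
    rw [dotProduct_add, ← pairing_add, ← pairing_add, pairingIn_comm P ρ α, htwin.1,
      P.pairingIn_same, P.pairingIn_same]
    norm_num
  obtain ⟨w, hw⟩ := exists_eq_two_nsmul_of_odd_det hdet (v := f + g) fun k => by
    rw [mulVec_eq]
    exact htwin.even_pairingIn_add hβ (r k)
  obtain ⟨n, hn⟩ := even_dotProduct_mulVec hC hdiag w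
  rw [hw, mulVec_smul, smul_dotProduct, dotProduct_smul, hn] at norm_eq
  simp only [nsmul_eq_mul] at norm_eq
  omega

theorem isAmple [P.IsRootSystem] [IsSimplyLaced P] (h : HasCartanMatrix P C)
    (hconn : IsConnectedMatrix C) (hl : 4 ≤ l) (hl' : 5 ≤ l ∨ Odd C.det) : IsAmple P := by
  have : NeZero l := ⟨by omega⟩
  have : P.IsIrreducible := h.isIrreducible hconn
  have hrank := h.finrank_eq
  refine ⟨exists_pairingIn_eq_one (by omega), exists_pairingIn_eq_one_and_eq_neg_one,
    fun {α β} hβ => ?_⟩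
  obtain ⟨ρ, hρ, htwin⟩ : ∃ ρ ∈ link P α β, ¬ IsTwin P α ρ := by
    rcases hl' with hl' | hdet
    · exact exists_mem_link_not_isTwin_of_finrank (by omega) hβ
    · obtain ⟨ρ, hρ⟩ := nonempty_link_of_finrank (by omega) hβ
      exact ⟨ρ, hρ, h.not_isTwin_of_odd_det hdet hβ⟩
  rw [IsTwin] at htwin
  push Not at htwin
  exact ⟨ρ, (pairingIn_comm P ρ α).trans hρ.1, hρ.2, htwin hρ.1⟩

end HasCartanMatrix

omit [CharZero K] in
theorem IsTypeADE.exists_hasCartanMatrix (hP : IsTypeADE P) :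
    ∃ (l : ℕ) (C : Matrix (Fin l) (Fin l) ℤ), HasCartanMatrix P C ∧ C.IsSymm ∧
      IsConnectedMatrix C ∧ 4 ≤ l ∧ (5 ≤ l ∨ Odd C.det) := by
  rcases hP with ⟨l, hl, h⟩ | ⟨l, hl, h⟩ | h | h | h
  · have : NeZero l := ⟨by omega⟩
    refine ⟨l, _, h, CartanMatrix.A_isSymm l, isConnectedMatrix_A l, hl, ?_⟩
    rcases hl.eq_or_lt with rfl | hl
    · exact .inr (by decide)
    · exact .inl hl
  · exact ⟨l, _, h, CartanMatrix.D_isSymm l, isConnectedMatrix_D (by omega), by omega, .inl hl⟩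
  · exact ⟨6, _, h, CartanMatrix.E₆_isSymm, isConnectedMatrix_E₆, by norm_num, by norm_num⟩
  · exact ⟨7, _, h, CartanMatrix.E₇_isSymm, isConnectedMatrix_E₇, by norm_num, by norm_num⟩
  · exact ⟨8, _, h, CartanMatrix.E₈_isSymm, isConnectedMatrix_E₈, by norm_num, by norm_num⟩

theorem IsTypeADE.isSimplyLaced [Finite ι] [P.IsReduced] (hP : IsTypeADE P) : IsSimplyLaced P := by
  obtain ⟨l, C, h, hC, hconn, -, -⟩ := hP.exists_hasCartanMatrix
  exact h.isSimplyLaced hC hconn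

theorem IsTypeADE.isAmple [P.IsRootSystem] [IsSimplyLaced P] (hP : IsTypeADE P) : IsAmple P := by
  obtain ⟨l, C, h, -, hconn, hl, hl'⟩ := hP.exists_hasCartanMatrix
  exact h.isAmple hconn hl hl'

end TypeADE

section StructureConstants

variable {ι K V W : Type*} [Field K] [CharZero K] [AddCommGroup V] [Module K V]
  [AddCommGroup W] [Module K W] (P : RootPairing ι K V W) [P.IsCrystallographic]

local notation "⟪" i "," j "⟫" => RootPairing.pairingIn P ℤ i j

/-- The identities between the structure constants of a Chevalley basis of a simply laced Lie
algebra on which the Steinberg relations depend. The last one is the Jacobi identity for three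
roots two of which are orthogonal. -/
class IsStructureConstants (N : ι → ι → ℤ) : Prop where
  mul_self {i j k : ι} (h : IsSum P i j k) : N i j * N i j = 1
  swap {i j k : ι} (h : IsSum P i j k) : N j i = -N i j
  jacobi {ρ β' β γ κ α : ι} (hβ : IsSum P ρ β' β) (hκ : IsSum P ρ γ κ) (h : ⟪β',γ⟫ = 0)
    (hβγ : IsSum P β γ α) (hβκ : IsSum P β' κ α) : N ρ β' * N β γ = -(N ρ γ * N β' κ)

variable {P}

omit [CharZero K] in
theorem IsStructureConstants.smul_smul {M : Type*} [AddCommGroup M] (N : ι → ι → ℤ)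
    [IsStructureConstants P N] {i j k : ι} (h : IsSum P i j k) (m : M) :
    N i j • N i j • m = m := by
  rw [_root_.smul_smul, mul_self h, one_smul]

omit [CharZero K] in
theorem IsStructureConstants.neg_mul_eq_mul (N : ι → ι → ℤ) [IsStructureConstants P N]
    {ρ β' β γ κ α : ι} (hβ : IsSum P ρ β' β) (hκ : IsSum P ρ γ κ) (h : ⟪β',γ⟫ = 0)
    (hβγ : IsSum P β γ α) (hβκ : IsSum P β' κ α) : -(N ρ γ * N ρ β') = N β' κ * N β γ := by
  linear_combination N ρ γ * N ρ β' * mul_self (N := N) hβκ +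
    N β' κ * N β γ * mul_self (N := N) hβ - N ρ β' * N β' κ * jacobi (N := N) hβ hκ h hβγ hβκ

theorem add_root_ne_zero {i j : ι} (h : ⟪i,j⟫ ≠ -2) : P.root i + P.root j ≠ 0 := by
  intro h0
  obtain rfl : i = P.reflectionPerm j j := P.root.injective (by
    rw [root_reflectionPerm_self, eq_neg_of_add_eq_zero_left h0])
  exact h (by rw [P.pairingIn_reflectionPerm_self_left, P.pairingIn_same])

variable [IsSimplyLaced P]

theorem add_root_notMem_range_root {i j : ι} (h : ⟪i,j⟫ ≠ -1) :
    P.root i + P.root j ∉ Set.range P.root := fun ⟨_, hk⟩ =>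
  h (IsSum.pairingIn_eq hk).1

namespace ChevalleyBasis

variable {L : Type*} [LieRing L] [LieAlgebra K L] (𝓒 : ChevalleyBasis P L)

theorem lie_e_of_nonneg {i j : ι} (h : 0 ≤ ⟪i,j⟫) : ⁅𝓒.e i, 𝓒.e j⁆ = 0 :=
  𝓒.lie_e_eq_zero i j (add_root_ne_zero (by omega)) (add_root_notMem_range_root (by omega))

omit [P.IsCrystallographic] [IsSimplyLaced P] in
theorem smul_e_injective (k : ι) : Function.Injective fun m : ℤ => m • 𝓒.e k := by
  intro m n h
  simp only [← Int.cast_smul_eq_zsmul K] at h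
  exact Int.cast_injective (smul_left_injective K (𝓒.e_linearIndependent.ne_zero k) h)

omit [CharZero K] [P.IsCrystallographic] [IsSimplyLaced P] in
theorem lie_lie_e {i j k l m : ι} (hk : IsSum P j k l) (hm : IsSum P i l m) :
    ⁅𝓒.e i, ⁅𝓒.e j, 𝓒.e k⁆⁆ = (𝓒.N j k * 𝓒.N i l) • 𝓒.e m := by
  rw [𝓒.lie_e_add _ _ _ hk, lie_zsmul, 𝓒.lie_e_add _ _ _ hm, smul_smul]

theorem lie_e_neg_lie_e {i j k : ι} (h : IsSum P i j k) :
    ⁅𝓒.e (P.reflectionPerm i i), ⁅𝓒.e i, 𝓒.e j⁆⁆ = 𝓒.e j := by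
  have hij := h.pairingIn_eq.1
  have orthogonal : ⁅𝓒.e (P.reflectionPerm i i), 𝓒.e j⁆ = 0 :=
    𝓒.lie_e_of_nonneg (by rw [P.pairingIn_reflectionPerm_self_left]; omega)
  have pairing_eq : P.toLinearMap (P.root j) (P.coroot (P.reflectionPerm i i)) = 1 := by
    rw [P.root_coroot_eq_pairing, ← P.algebraMap_pairingIn ℤ,
      P.pairingIn_reflectionPerm_self_right, pairingIn_comm, hij]
    simp
  rw [leibniz_lie, orthogonal, lie_zero, add_zero,
    𝓒.lie_e_neg _ i (by rw [root_reflectionPerm_self, neg_neg]), 𝓒.lie_h_e, pairing_eq, one_smul]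

theorem N_mul_self {i j k : ι} (h : IsSum P i j k) : 𝓒.N i j * 𝓒.N i j = 1 := by
  have hj : IsSum P (P.reflectionPerm i i) k j := by
    rw [IsSum, root_reflectionPerm_self, h, neg_add_cancel_left]
  have hunit : 𝓒.N i j * 𝓒.N (P.reflectionPerm i i) k = 1 := 𝓒.smul_e_injective j <| by
    simp only [← 𝓒.lie_lie_e h hj, 𝓒.lie_e_neg_lie_e h, one_smul]
  exact Int.isUnit_mul_self (IsUnit.of_mul_eq_one _ hunit)

instance isStructureConstants : IsStructureConstants P 𝓒.N where
  mul_self h := 𝓒.N_mul_self h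
  swap {i j k} h := 𝓒.smul_e_injective k <| by
    simp only [neg_smul, ← 𝓒.lie_e_add _ _ _ h, ← 𝓒.lie_e_add _ _ _ h.symm, lie_skew]
  jacobi {ρ β' β γ κ α} hβ hκ h hβγ hβκ := 𝓒.smul_e_injective α <| by
    have left : ⁅⁅𝓒.e ρ, 𝓒.e β'⁆, 𝓒.e γ⁆ = (𝓒.N ρ β' * 𝓒.N β γ) • 𝓒.e α := by
      rw [𝓒.lie_e_add _ _ _ hβ, zsmul_lie, 𝓒.lie_e_add _ _ _ hβγ, smul_smul]
    simp only [← left, neg_smul, ← 𝓒.lie_lie_e hκ hβκ]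
    rw [lie_lie, 𝓒.lie_e_of_nonneg h.ge, lie_zero, zero_sub]

end ChevalleyBasis

end StructureConstants

open scoped commutatorElement

section Commutators

variable {G : Type*} [Group G]

theorem commute_commutatorElement {z u v : G} (hu : Commute z u) (hv : Commute z v) :
    Commute z ⁅u, v⁆ := by
  rw [commutatorElement_def]
  exact ((hu.mul_right hv).mul_right hu.inv_right).mul_right hv.inv_right

theorem commutatorElement_commutatorElement_left {r s g : G} (h : Commute s g) :
    ⁅⁅r, s⁆, g⁆ = r * ⁅s, ⁅r⁻¹, g⁆⁆ * r⁻¹ := by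
  have conj_eq : ⁅s * r⁻¹ * s⁻¹, g⁆ = s * ⁅r⁻¹, g⁆ * s⁻¹ := by
    rw [conjugate_commutatorElement, h.mul_inv_cancel]
  calc ⁅⁅r, s⁆, g⁆ = ⁅r * (s * r⁻¹ * s⁻¹), g⁆ := by simp only [commutatorElement_def, mul_assoc]
    _ = r * (s * ⁅r⁻¹, g⁆ * s⁻¹) * r⁻¹ * ⁅r, g⁆ := by
      rw [commutatorElement_mul_left_eq_conj_mul, conj_eq]
    _ = r * ⁅s, ⁅r⁻¹, g⁆⁆ * r⁻¹ := by
      simp only [commutatorElement_def]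
      group

theorem commute_commutatorElement_of_commute {z u v : G} (hv : Commute z v)
    (hzuv : Commute ⁅z, u⁆ v) (h : Commute ⁅z, u⁆ ⁅u, v⁆) : Commute z ⁅u, v⁆ := by
  have conj_eq : z * u * z⁻¹ = ⁅z, u⁆ * u := conj_eq_commutatorElement_mul
  refine mul_inv_eq_iff_eq_mul.1 ?_
  rw [conjugate_commutatorElement, conj_eq, hv.mul_inv_cancel,
    commutatorElement_mul_left_eq_conj_mul, h.mul_inv_cancel, hzuv.commutator_eq, mul_one]

theorem commutatorElement_mul_right_of_commute {u v w : G} (h : Commute v ⁅u, w⁆) :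
    ⁅u, v * w⁆ = ⁅u, v⁆ * ⁅u, w⁆ := by
  rw [commutatorElement_mul_right_eq_mul_conj, mul_assoc ⁅u, v⁆, mul_assoc, h.mul_inv_cancel]

theorem commutatorElement_mul_left_of_commute {u v w : G} (h : Commute u ⁅v, w⁆) :
    ⁅u * v, w⁆ = ⁅v, w⁆ * ⁅u, w⁆ := by
  rw [commutatorElement_mul_left_eq_conj_mul, h.mul_inv_cancel]

end Commutators

/-- An element `t` of degree `1` such that multiplication by `t` is injective and maps `B d` onto
`B (d + 1)` for all `d ≥ 0`. For a graded ring `B` this says that the part of nonnegative degree is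
the polynomial ring in `t` over `B 0`. -/
structure IsPolynomialGenerator {R : Type*} [CommRing R] (B : ℤ → AddSubgroup R) (t : R) :
    Prop where
  mem : t ∈ B 1
  isLeftRegular : IsLeftRegular t
  exists_eq_mul {d : ℤ} {c : R} (hd : 0 ≤ d) (hc : c ∈ B (d + 1)) : ∃ c' ∈ B d, c = t * c'

namespace IsPolynomialGenerator

variable {R : Type*} [CommRing R] {B : ℤ → AddSubgroup R} {t : R} (ht : IsPolynomialGenerator B t)
include ht

theorem pow_mem [SetLike.GradedMonoid B] (k : ℕ) : t ^ k ∈ B k := by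
  simpa using SetLike.pow_mem_graded k ht.mem

theorem exists_eq_pow_mul (k : ℕ) {d : ℤ} {c : R} (hd : 0 ≤ d) (hc : c ∈ B (d + k)) :
    ∃ c' ∈ B d, c = t ^ k * c' := by
  induction k generalizing c with
  | zero => exact ⟨c, by simpa using hc, by simp⟩
  | succ k ih =>
    obtain ⟨c₁, hc₁, rfl⟩ := ht.exists_eq_mul (d := d + k) (c := c) (by omega)
      (by simpa [add_assoc] using hc)
    obtain ⟨c₂, hc₂, rfl⟩ := ih hc₁
    exact ⟨c₂, hc₂, by ring⟩

end IsPolynomialGenerator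

section Decompositions

variable {ι K V W : Type*} [Field K] [CharZero K] [AddCommGroup V] [Module K V]
  [AddCommGroup W] [Module K W] {P : RootPairing ι K V W} [P.IsCrystallographic] [IsSimplyLaced P]
  {α β γ β' γ' : ι}

local notation "⟪" i "," j "⟫" => RootPairing.pairingIn P ℤ i j

theorem IsSum.exists_isSum_sub (h : IsSum P β γ α) (h' : IsSum P β' γ' α) (hp : ⟪β,β'⟫ = 1) :
    ∃ ρ, IsSum P ρ β' β ∧ IsSum P ρ γ γ' ∧ ⟪β',γ⟫ = 0 := by
  obtain ⟨ρ, hρ⟩ := exists_isSum_of_pairingIn_eq_one hp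
  refine ⟨ρ, hρ.symm, add_left_cancel (a := P.root β') ?_, ?_⟩
  · rw [← h', h, hρ, add_assoc]
  · have hα := h.pairingIn_right β'
    have hβ' := h'.pairingIn_eq
    have hβ := pairingIn_comm P β β'
    omega

omit [CharZero K] in
theorem exists_isSum_left_right [IsAmple P] (α : ι) : ∃ β γ, IsSum P β γ α := by
  obtain ⟨β, hβ⟩ := IsAmple.exists_acute (P := P) α
  exact ⟨β, exists_isSum_of_pairingIn_eq_one ((pairingIn_comm P α β).trans hβ)⟩

theorem IsSum.exists_adjacent [IsAmple P] (h : IsSum P β γ α) :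
    ∃ β' γ', IsSum P β' γ' α ∧ ⟪β,β'⟫ = 1 := by
  have hβα := h.pairingIn_eq.2.1
  obtain ⟨ρ, hρα, hρβ, -⟩ := IsAmple.exists_orthogonal hβα
  obtain ⟨β', hβ'⟩ := exists_isSum_of_pairingIn_eq_one ((pairingIn_comm P β ρ).trans hρβ)
  have hαβ' : ⟪α,β'⟫ = 1 := by
    have := hβ'.pairingIn_left α
    have := pairingIn_comm P α β'
    omega
  obtain ⟨γ', hγ'⟩ := exists_isSum_of_pairingIn_eq_one hαβ'
  exact ⟨β', γ', hγ', (pairingIn_comm P β β').trans hβ'.pairingIn_eq.2.2⟩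

end Decompositions

section SteinbergFamily

variable {ι K V W R G : Type*} [Field K] [AddCommGroup V] [Module K V]
  [AddCommGroup W] [Module K W] (P : RootPairing ι K V W) [P.IsCrystallographic]
  [CommRing R] [Group G] (N : ι → ι → ℤ) (B : ℤ → AddSubgroup R) (n : ℤ)

local notation "⟪" i "," j "⟫" => RootPairing.pairingIn P ℤ i j

/-- A family of elements `x i a` of a group satisfies the defining relations of the truncated
Steinberg group of level `n`. The values `x i a` with `a` not homogeneous of degree at most `n` are
junk. -/
structure IsSteinbergFamily (x : ι → R → G) : Prop where
  map_add (i : ι) {d : ℤ} {a b : R} (hd : d ≤ n) (ha : a ∈ B d) (hb : b ∈ B d) :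
    x i (a + b) = x i a * x i b
  commutator_eq {i j k : ι} {d e : ℤ} {a b : R} (h : IsSum P i j k) (hd : d ≤ n) (he : e ≤ n)
    (hde : d + e ≤ n) (ha : a ∈ B d) (hb : b ∈ B e) : ⁅x i a, x j b⁆ = x k (N i j • (a * b))
  commute {i j : ι} {d e : ℤ} {a b : R} (h : ⟪i,j⟫ = 0 ∨ ⟪i,j⟫ = 1) (hd : d ≤ n) (he : e ≤ n)
    (ha : a ∈ B d) (hb : b ∈ B e) : Commute (x i a) (x j b)

namespace IsSteinbergFamily

variable {P N B n} {x : ι → R → G} (H : IsSteinbergFamily P N B n x)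
include H

theorem congr [SetLike.GradedMonoid B] {y : ι → R → G}
    (hy : ∀ i d a, d ≤ n → a ∈ B d → y i a = x i a) : IsSteinbergFamily P N B n y where
  map_add i d a b hd ha hb := by
    rw [hy i d a hd ha, hy i d b hd hb, hy i d _ hd (add_mem ha hb), H.map_add i hd ha hb]
  commutator_eq {i j k d e a b} h hd he hde ha hb := by
    rw [hy i d a hd ha, hy j e b he hb,
      hy k _ _ hde (zsmul_mem (SetLike.mul_mem_graded ha hb) _), H.commutator_eq h hd he hde ha hb]
  commute {i j d e a b} h hd he ha hb := by
    rw [hy i d a hd ha, hy j e b he hb]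
    exact H.commute h hd he ha hb

theorem map_zero (i : ι) : x i 0 = 1 := by
  simpa using H.map_add i le_rfl (zero_mem (B n)) (zero_mem (B n))

theorem map_neg (i : ι) {d : ℤ} {a : R} (hd : d ≤ n) (ha : a ∈ B d) : x i (-a) = (x i a)⁻¹ := by
  have map_sub := H.map_add i hd (neg_mem ha) ha
  rw [neg_add_cancel, H.map_zero] at map_sub
  exact eq_inv_of_mul_eq_one_left map_sub.symm

variable [CharZero K] [IsSimplyLaced P] [IsAmple P] [IsStructureConstants P N]
  [SetLike.GradedMonoid B] {α β γ δ β' γ' ρ κ : ι} {d e f d' e' : ℤ} {a b c a' b' : R}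

section

variable (hn : 1 ≤ n)
include hn

theorem commute_self (i : ι) (hd : d ≤ n) (he : e ≤ n) (ha : a ∈ B d) (hb : b ∈ B e) :
    Commute (x i a) (x i b) := by
  obtain ⟨β, γ, h⟩ := exists_isSum_left_right (P := P) i
  have one_mem := SetLike.one_mem_graded B
  have hb' := zsmul_mem hb (N β γ)
  have commutator_eq := H.commutator_eq h (by omega) he (by omega) one_mem hb'
  rw [one_mul, IsStructureConstants.smul_smul N h] at commutator_eq
  rw [← commutator_eq]
  have := h.pairingIn_eq
  have := pairingIn_comm P i β
  have := pairingIn_comm P i γ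
  exact commute_commutatorElement (H.commute (.inr (by omega)) hd (by omega) ha one_mem)
    (H.commute (.inr (by omega)) hd he ha hb')

theorem commute_of_nonneg {i j : ι} (h : 0 ≤ ⟪i,j⟫) (hd : d ≤ n) (he : e ≤ n) (ha : a ∈ B d)
    (hb : b ∈ B e) : Commute (x i a) (x j b) := by
  by_cases hij : i = j
  · subst hij
    exact H.commute_self hn i hd he ha hb
  · have := IsSimplyLaced.pairingIn_le_one (P := P) hij
    exact H.commute (by omega) hd he ha hb

theorem commute_commutator (hβ : 0 ≤ ⟪δ,β⟫) (hγ : 0 ≤ ⟪δ,γ⟫) (hd : d ≤ n) (he : e ≤ n)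
    (hf : f ≤ n) (ha : a ∈ B d) (hb : b ∈ B e) (hc : c ∈ B f) :
    Commute (x δ c) ⁅x β a, x γ b⁆ :=
  commute_commutatorElement (H.commute_of_nonneg hn hβ hf hd hc ha)
    (H.commute_of_nonneg hn hγ hf he hc hb)

theorem commute_commutator_of_obtuse (hβγ : ⟪β,γ⟫ = -1) (hβ : ⟪δ,β⟫ = -1) (hγ : ⟪δ,γ⟫ = 1)
    (hd : d ≤ n) (he : e ≤ n) (hf : f ≤ n) (hfd : f + d ≤ n) (ha : a ∈ B d) (hb : b ∈ B e)
    (hc : c ∈ B f) : Commute (x δ c) ⁅x β a, x γ b⁆ := by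
  obtain ⟨k, hk⟩ := exists_isSum hβ
  have hkγ := hk.pairingIn_left γ
  have hkβ := hk.pairingIn_left β
  rw [P.pairingIn_same] at hkβ
  have hca : N δ β • (c * a) ∈ B (f + d) := zsmul_mem (SetLike.mul_mem_graded hc ha) _
  refine commute_commutatorElement_of_commute (H.commute (.inr hγ) hf he hc hb) ?_ ?_ <;>
    rw [H.commutator_eq hk hf hd hfd hc ha]
  · exact H.commute (.inl (by omega)) hfd he hca hb
  · exact H.commute_commutator hn (by omega) (by omega) hd he hfd ha hb hca

/-- The summand `ρ` of `β = ρ + β'` moves to the other factor. Every change of decomposition is made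
of such moves. -/
theorem commutator_eq_commutator (hβ : IsSum P ρ β' β) (hκ : IsSum P ρ γ κ) (h : ⟪β',γ⟫ = 0)
    (hd : d ≤ n) (he : e ≤ n) (hf : f ≤ n) (hde : d + e ≤ n) (hdf : d + f ≤ n) (ha : a ∈ B d)
    (hb : b ∈ B e) (hc : c ∈ B f) :
    ⁅x β (N ρ β' • (a * b)), x γ c⁆ = ⁅x β' b, x κ (-(N ρ γ • (a * c)))⁆ := by
  have hcomm : Commute (x ρ a) ⁅x β' b, x κ (-(N ρ γ • (a * c)))⁆ := by
    have hρβ' := hβ.pairingIn_eq.1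
    have hρκ := hκ.pairingIn_eq.2.1
    have hβ'κ := hκ.pairingIn_right β'
    have := pairingIn_comm P ρ β'
    exact H.commute_commutator_of_obtuse hn (by omega) hρβ' hρκ he hdf hd hde hb
      (neg_mem (zsmul_mem (SetLike.mul_mem_graded ha hc) _)) ha
  rw [← H.commutator_eq hβ hd he hde ha hb,
    commutatorElement_commutatorElement_left (H.commute (.inl h) he hf hb hc),
    ← H.map_neg ρ hd ha, H.commutator_eq hκ hd hf hdf (neg_mem ha) hc, neg_mul, smul_neg,
    H.map_neg ρ hd ha, hcomm.mul_inv_cancel]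

theorem commutator_map_add (h : IsSum P β γ α) (hd : d ≤ n) (he : e ≤ n) (ha : a ∈ B d)
    (hb : b ∈ B e) (hc : c ∈ B e) : ⁅x β a, x γ (b + c)⁆ = ⁅x β a, x γ b⁆ * ⁅x β a, x γ c⁆ := by
  obtain ⟨β', γ', h', hp⟩ := h.exists_adjacent
  obtain ⟨ρ, hβ, hγ', hβ'γ⟩ := h.exists_isSum_sub h' hp
  have move := H.commutator_eq_commutator hn hβ hγ' hβ'γ (by omega) hd he (by omega) (by omega)
    (SetLike.one_mem_graded B) (zsmul_mem ha (N ρ β')) hc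
  rw [one_mul, IsStructureConstants.smul_smul N hβ, one_mul] at move
  rw [H.map_add γ he hb hc]
  apply commutatorElement_mul_right_of_commute
  rw [move]
  have hγγ' := hγ'.pairingIn_eq.2.2
  have := pairingIn_comm P γ β'
  exact H.commute_commutator hn (by omega) (by omega) hd he he (zsmul_mem ha _)
    (neg_mem (zsmul_mem hc _)) hb

theorem commutator_map_neg (h : IsSum P β γ α) (hd : d ≤ n) (he : e ≤ n) (ha : a ∈ B d)
    (hb : b ∈ B e) : ⁅x β a, x γ (-b)⁆ = ⁅x β a, x γ b⁆⁻¹ := by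
  have map_sub := H.commutator_map_add hn h hd he ha (neg_mem hb) hb
  rw [neg_add_cancel, H.map_zero, commutatorElement_one_right] at map_sub
  exact eq_inv_of_mul_eq_one_left map_sub.symm

variable {t : R} (ht : IsPolynomialGenerator B t)
include ht

theorem commutator_eq_commutator_generator (h : IsSum P β γ α) (h' : IsSum P β' γ' α)
    (hp : ⟪β,β'⟫ = 1) (hd : 1 ≤ d) (he : 1 ≤ e) (hde : d + e = n + 1) (ha : a ∈ B d)
    (hb : b ∈ B e) (hc : N β' γ' • (t * c) = N β γ • (a * b)) :
    ⁅x β a, x γ b⁆ = ⁅x β' t, x γ' c⁆ := by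
  obtain ⟨ρ, hβ, hγ', hβ'γ⟩ := h.exists_isSum_sub h' hp
  obtain ⟨a₀, ha₀, rfl⟩ := ht.exists_eq_mul (d := d - 1) (by omega) (by simpa using ha)
  have move := H.commutator_eq_commutator hn hβ hγ' hβ'γ (by omega) hn (by omega) (by omega)
    (by omega) (zsmul_mem ha₀ (N ρ β')) ht.mem hb
  have c_eq : c = -(N ρ γ • (N ρ β' • a₀ * b)) := ht.isLeftRegular <|
    calc t * c = N β' γ' • N β γ • (t * a₀ * b) := by
          rw [← hc, IsStructureConstants.smul_smul N h']
      _ = -(N ρ γ * N ρ β') • (t * a₀ * b) := by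
          rw [smul_smul, IsStructureConstants.neg_mul_eq_mul N hβ hγ' hβ'γ h h']
      _ = t * -(N ρ γ • (N ρ β' • a₀ * b)) := by
          simp only [zsmul_eq_mul, Int.cast_neg, Int.cast_mul]
          ring
  rwa [smul_mul_assoc, IsStructureConstants.smul_smul N hβ, mul_comm a₀, ← c_eq] at move

theorem commutator_congr_of_mul_eq_mul (h : IsSum P β γ α) (hd : 1 ≤ d) (he : 1 ≤ e)
    (hde : d + e = n + 1) (hd' : 1 ≤ d') (he' : 1 ≤ e') (hde' : d' + e' = n + 1) (ha : a ∈ B d)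
    (hb : b ∈ B e) (ha' : a' ∈ B d') (hb' : b' ∈ B e') (hab : a * b = a' * b') :
    ⁅x β a, x γ b⁆ = ⁅x β a', x γ b'⁆ := by
  obtain ⟨β₂, γ₂, h₂, hp⟩ := h.exists_adjacent
  obtain ⟨a₀, -, rfl⟩ := ht.exists_eq_mul (d := d - 1) (by omega) (by simpa using ha)
  have hc : N β₂ γ₂ • (t * (N β₂ γ₂ • N β γ • (a₀ * b))) = N β γ • (t * a₀ * b) := by
    simp only [mul_smul_comm, IsStructureConstants.smul_smul N h₂, mul_assoc]
  rw [H.commutator_eq_commutator_generator hn ht h h₂ hp hd he hde ha hb hc,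
    H.commutator_eq_commutator_generator hn ht h h₂ hp hd' he' hde' ha' hb' (by rw [hc, hab])]

theorem commutator_congr_of_one_le (h : IsSum P β γ α) (h' : IsSum P β' γ' α)
    (hp : 1 ≤ ⟪β,β'⟫) (hd : 1 ≤ d) (he : 1 ≤ e) (hde : d + e = n + 1) (hd' : 1 ≤ d')
    (he' : 1 ≤ e') (hde' : d' + e' = n + 1) (ha : a ∈ B d) (hb : b ∈ B e) (ha' : a' ∈ B d')
    (hb' : b' ∈ B e') (hab : N β γ • (a * b) = N β' γ' • (a' * b')) :
    ⁅x β a, x γ b⁆ = ⁅x β' a', x γ' b'⁆ := by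
  by_cases hββ' : β = β'
  · subst hββ'
    obtain rfl : γ = γ' := P.root.injective
      (add_left_cancel ((show P.root α = _ from h).symm.trans h'))
    refine H.commutator_congr_of_mul_eq_mul hn ht h hd he hde hd' he' hde' ha hb ha' hb' ?_
    rw [← IsStructureConstants.smul_smul N h (a * b), hab, IsStructureConstants.smul_smul N h]
  · have hle := IsSimplyLaced.pairingIn_le_one (P := P) hββ'
    obtain ⟨a₀, ha₀, rfl⟩ := ht.exists_eq_mul (d := d' - 1) (by omega) (by simpa using ha')
    have hc : a₀ * b' ∈ B n := by
      simpa [show d' - 1 + e' = n by omega] using SetLike.mul_mem_graded ha₀ hb'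
    calc ⁅x β a, x γ b⁆ = ⁅x β' t, x γ' (a₀ * b')⁆ :=
          H.commutator_eq_commutator_generator hn ht h h' (by omega) hd he hde ha hb
            (by rw [hab, mul_assoc])
      _ = ⁅x β' (t * a₀), x γ' b'⁆ :=
          H.commutator_congr_of_mul_eq_mul hn ht h' le_rfl hn (by omega) hd' he' hde' ht.mem hc
            ha' hb' (mul_assoc _ _ _).symm

theorem commutator_congr (h : IsSum P β γ α) (h' : IsSum P β' γ' α) (hd : 1 ≤ d) (he : 1 ≤ e)
    (hde : d + e = n + 1) (hd' : 1 ≤ d') (he' : 1 ≤ e') (hde' : d' + e' = n + 1) (ha : a ∈ B d)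
    (hb : b ∈ B e) (ha' : a' ∈ B d') (hb' : b' ∈ B e')
    (hab : N β γ • (a * b) = N β' γ' • (a' * b')) : ⁅x β a, x γ b⁆ = ⁅x β' a', x γ' b'⁆ := by
  by_cases hp : 1 ≤ ⟪β,β'⟫
  · exact H.commutator_congr_of_one_le hn ht h h' hp hd he hde hd' he' hde' ha hb ha' hb' hab
  · have hβα := h.pairingIn_eq.2.1
    have hβ := h'.pairingIn_right β
    rw [← commutatorElement_inv (x γ' b'),
      ← H.commutator_map_neg hn h'.symm (by omega) (by omega) hb' ha']
    refine H.commutator_congr_of_one_le hn ht h h'.symm (by omega) hd he hde he' hd' (by omega)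
      ha hb hb' (neg_mem ha') ?_
    rw [hab, IsStructureConstants.swap (N := N) h', mul_neg, smul_neg, neg_smul, neg_neg, mul_comm]

end

end IsSteinbergFamily

end SteinbergFamily

section AuxiliaryRoots

variable {ι K V W : Type*} [Field K] [CharZero K] [AddCommGroup V] [Module K V]
  [AddCommGroup W] [Module K W] {P : RootPairing ι K V W} [P.IsCrystallographic] [IsSimplyLaced P]
  [IsAmple P] {α δ ε ρ : ι}

local notation "⟪" i "," j "⟫" => RootPairing.pairingIn P ℤ i j

theorem IsSum.exists_orthogonal_summand (h : IsSum P α δ ε) :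
    ∃ μ ν κ, IsSum P μ ν α ∧ IsSum P μ δ κ ∧ IsSum P ν κ ε ∧ ⟪ν,δ⟫ = 0 ∧ ⟪μ,ε⟫ = 0 ∧
      ∃ σ, ⟪σ,ε⟫ = 1 ∧ ⟪σ,μ⟫ = 0 := by
  obtain ⟨μ, hμε, hμα, hσ⟩ := IsAmple.exists_orthogonal h.pairingIn_eq.2.1
  obtain ⟨ν, hν⟩ := exists_isSum_of_pairingIn_eq_one ((pairingIn_comm P α μ).trans hμα)
  have hαδ := h.pairingIn_eq.1
  have hμδ := h.pairingIn_right μ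
  have hνδ := hν.pairingIn_left δ
  obtain ⟨κ, hκ⟩ := exists_isSum (P := P) (show ⟪μ,δ⟫ = -1 by omega)
  refine ⟨μ, ν, κ, hν, hκ, ?_, by omega, hμε, hσ⟩
  rw [IsSum, hκ, h, hν]
  abel

theorem exists_isSum_of_pairingIn_eq_zero (h : ⟪α,ρ⟫ = 0) :
    ∃ β β' γ κ, IsSum P ρ β' β ∧ IsSum P ρ γ κ ∧ ⟪β',γ⟫ = 0 ∧ IsSum P β γ α ∧
      IsSum P β' κ α := by
  obtain ⟨β', hβ'α, hβ'ρ⟩ := IsAmple.exists_acute_obtuse h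
  obtain ⟨β, hβ⟩ := exists_isSum ((pairingIn_comm P ρ β').trans hβ'ρ)
  have hαβ : ⟪α,β⟫ = 1 := by
    have := hβ.pairingIn_right α
    have := pairingIn_comm P β' α
    omega
  obtain ⟨γ, hγ⟩ := exists_isSum_of_pairingIn_eq_one hαβ
  have hρα := hγ.pairingIn_right ρ
  have hβ'α := hγ.pairingIn_right β'
  have hρβ := hβ.pairingIn_eq
  have := pairingIn_comm P ρ α
  obtain ⟨κ, hκ⟩ := exists_isSum (P := P) (show ⟪ρ,γ⟫ = -1 by omega)
  refine ⟨β, β', γ, κ, hβ, hκ, by omega, hγ, ?_⟩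
  rw [IsSum, hκ, hγ, hβ]
  abel

theorem exists_isSum_acute_of_pairingIn_eq_zero (h : ⟪α,ρ⟫ = 0) :
    ∃ β γ ε, IsSum P β γ ρ ∧ IsSum P α γ ε ∧ ⟪α,β⟫ = 1 ∧ ⟪ε,ρ⟫ = 1 ∧ ⟪ε,β⟫ = 0 := by
  obtain ⟨σ, hσα, hσρ⟩ := IsAmple.exists_acute_obtuse h
  obtain ⟨β, hβ⟩ := exists_isSum hσρ
  have hβα := hβ.pairingIn_left α
  have hρβ := hβ.pairingIn_eq.2.2
  obtain ⟨γ, hγ⟩ := exists_isSum_of_pairingIn_eq_one hρβ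
  have hαρ := hγ.pairingIn_right α
  have := pairingIn_comm P α ρ
  have := pairingIn_comm P α β
  obtain ⟨ε, hε⟩ := exists_isSum (P := P) (show ⟪α,γ⟫ = -1 by omega)
  have hερ := hε.pairingIn_left ρ
  have hεβ := hε.pairingIn_left β
  have hβγ := hγ.pairingIn_eq
  have := pairingIn_comm P γ β
  exact ⟨β, γ, ε, hγ, hε, by omega, by omega, by omega⟩

end AuxiliaryRoots

section ToppedFamily

variable {ι K V W R G : Type*} [Field K] [AddCommGroup V] [Module K V]
  [AddCommGroup W] [Module K W] (P : RootPairing ι K V W) [P.IsCrystallographic]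
  [CommRing R] [Group G] (N : ι → ι → ℤ) (B : ℤ → AddSubgroup R) (n : ℤ)

local notation "⟪" i "," j "⟫" => RootPairing.pairingIn P ℤ i j

/-- `IsTopCommutator P N B n x α c z` says that the relations of level `n + 1` force the value `z`
on the generator of the root `α` at `c`, in degree `n + 1`, because `z` is a commutator of members
of the family `x` of positive degree. -/
inductive IsTopCommutator (x : ι → R → G) : ι → R → G → Prop
  | mk {α β γ : ι} {d e : ℤ} {a b : R} (h : IsSum P β γ α) (hd : 1 ≤ d) (he : 1 ≤ e)
    (hde : d + e = n + 1) (ha : a ∈ B d) (hb : b ∈ B e) :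
    IsTopCommutator x α (N β γ • (a * b)) ⁅x β a, x γ b⁆

/-- A Steinberg family of level `n` whose values in degree `n + 1` are the commutators that the
relations of level `n + 1` prescribe. -/
structure IsToppedFamily (x : ι → R → G) : Prop extends IsSteinbergFamily P N B n x where
  eq_of_isTopCommutator {α : ι} {c : R} {z : G} (h : IsTopCommutator P N B n x α c z) : x α c = z

variable {P N B n} {x : ι → R → G}

namespace IsToppedFamily

variable (H : IsToppedFamily P N B n x) {α β γ : ι} {d e : ℤ} {a b c : R}
include H

theorem commutator_eq_of_le (h : IsSum P β γ α) (hd : d ≤ n) (he : e ≤ n) (hde : d + e ≤ n + 1)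
    (ha : a ∈ B d) (hb : b ∈ B e) : ⁅x β a, x γ b⁆ = x α (N β γ • (a * b)) := by
  rcases eq_or_lt_of_le hde with hde | hde
  · exact (H.eq_of_isTopCommutator (.mk h (by omega) (by omega) hde ha hb)).symm
  · exact H.commutator_eq h hd he (by omega) ha hb

variable [IsStructureConstants P N] (hn : 1 ≤ n) {t : R} (ht : IsPolynomialGenerator B t)
include hn ht

theorem commutator_generator (h : IsSum P β γ α) (hc : c ∈ B n) :
    ⁅x β t, x γ (N β γ • c)⁆ = x α (t * c) := by
  rw [← H.eq_of_isTopCommutator (.mk h le_rfl hn (by omega) ht.mem (zsmul_mem hc _)),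
    mul_smul_comm, IsStructureConstants.smul_smul N h]

theorem exists_commutator_generator_eq (h : IsSum P β γ α) (hc : c ∈ B (n + 1)) :
    ∃ c' ∈ B n, x α c = ⁅x β t, x γ c'⁆ := by
  obtain ⟨c₀, hc₀, rfl⟩ := ht.exists_eq_mul (by omega) hc
  exact ⟨_, zsmul_mem hc₀ _, (H.commutator_generator hn ht h hc₀).symm⟩

end IsToppedFamily

variable [CharZero K] [IsSimplyLaced P] [IsAmple P] [IsStructureConstants P N] (hn : 1 ≤ n) {t : R}
  (ht : IsPolynomialGenerator B t)

namespace IsSteinbergFamily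

variable (H : IsSteinbergFamily P N B n x)
include H hn ht

theorem eq_of_isTopCommutator_of_isTopCommutator [SetLike.GradedMonoid B] {α : ι} {c : R}
    {z z' : G} (h : IsTopCommutator P N B n x α c z) (h' : IsTopCommutator P N B n x α c z') :
    z = z' := by
  obtain @⟨β, γ, d, e, a, b, hα, hd, he, hde, ha, hb⟩ := h
  generalize hc : N β γ • (a * b) = c at h'
  obtain ⟨hα', hd', he', hde', ha', hb'⟩ := h'
  exact H.commutator_congr hn ht hα hα' hd he hde hd' he' hde' ha hb ha' hb' hc

omit [CharZero K] [IsStructureConstants P N] in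
theorem isTopCommutator_zero (α : ι) :
    IsTopCommutator P N B n x α 0 1 := by
  obtain ⟨β, γ, h⟩ := exists_isSum_left_right (P := P) α
  simpa [H.map_zero] using IsTopCommutator.mk (N := N) (x := x) (n := n) h le_rfl hn (by omega)
    ht.mem (zero_mem (B n))

theorem eq_of_isTopCommutator_of_mem [GradedRing B] {α : ι} {d : ℤ} {c : R} {z : G} (hd : d ≤ n)
    (hc : c ∈ B d) (h : IsTopCommutator P N B n x α c z) : x α c = z := by
  have mem_top : c ∈ B (n + 1) := by
    cases h with
    | mk _ _ _ hde ha hb => exact hde ▸ zsmul_mem (SetLike.mul_mem_graded ha hb) _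
  obtain rfl : c = 0 := by
    by_contra hc0
    have := DirectSum.degree_eq_of_mem_mem B hc mem_top hc0
    omega
  rw [H.map_zero]
  exact H.eq_of_isTopCommutator_of_isTopCommutator hn ht (H.isTopCommutator_zero hn ht α) h

theorem exists_isToppedFamily [GradedRing B] : ∃ y : ι → R → G, IsToppedFamily P N B n y ∧
    ∀ i d a, d ≤ n → a ∈ B d → y i a = x i a := by
  have exists_value (i : ι) (a : R) : ∃ z : G, ((∃ d ≤ n, a ∈ B d) → z = x i a) ∧
      ∀ z', IsTopCommutator P N B n x i a z' → z = z' := by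
    by_cases ha : ∃ d ≤ n, a ∈ B d
    · obtain ⟨d, hd, ha⟩ := ha
      exact ⟨x i a, fun _ => rfl, fun _ => H.eq_of_isTopCommutator_of_mem hn ht hd ha⟩
    by_cases hz : ∃ z, IsTopCommutator P N B n x i a z
    · obtain ⟨z, hz⟩ := hz
      exact ⟨z, fun h => absurd h ha,
        fun _ => H.eq_of_isTopCommutator_of_isTopCommutator hn ht hz⟩
    · exact ⟨1, fun h => absurd h ha, fun z' h => absurd ⟨z', h⟩ hz⟩
  choose y hyx hytop using exists_value
  have hy (i : ι) (d : ℤ) (a : R) (hd : d ≤ n) (ha : a ∈ B d) : y i a = x i a :=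
    hyx i a ⟨d, hd, ha⟩
  refine ⟨y, ⟨H.congr hy, ?_⟩, hy⟩
  rintro _ _ _ ⟨h, hd, he, hde, ha, hb⟩
  rw [hy _ _ _ (by omega) ha, hy _ _ _ (by omega) hb]
  exact hytop _ _ _ (.mk h hd he hde ha hb)

end IsSteinbergFamily

namespace IsToppedFamily

variable (H : IsToppedFamily P N B n x) [SetLike.GradedMonoid B] {α β γ δ ε ρ σ : ι} {d e f : ℤ}
  {a b c u : R}
include H hn ht

theorem map_add_top (i : ι) (ha : a ∈ B (n + 1)) (hb : b ∈ B (n + 1)) :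
    x i (a + b) = x i a * x i b := by
  obtain ⟨β, γ, h⟩ := exists_isSum_left_right (P := P) i
  obtain ⟨a₀, ha₀, rfl⟩ := ht.exists_eq_mul (by omega) ha
  obtain ⟨b₀, hb₀, rfl⟩ := ht.exists_eq_mul (by omega) hb
  rw [← mul_add, ← H.commutator_generator hn ht h (add_mem ha₀ hb₀),
    ← H.commutator_generator hn ht h ha₀, ← H.commutator_generator hn ht h hb₀, smul_add,
    H.commutator_map_add hn h hn le_rfl ht.mem (zsmul_mem ha₀ _) (zsmul_mem hb₀ _)]

theorem commute_top_of_acute (hδα : ⟪δ,α⟫ = 1) (he : e ≤ n) (hb : b ∈ B e)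
    (hc : c ∈ B (n + 1)) : Commute (x δ b) (x α c) := by
  obtain ⟨γ, h⟩ := exists_isSum_of_pairingIn_eq_one ((pairingIn_comm P α δ).trans hδα)
  obtain ⟨β', γ', h', hδβ'⟩ := h.exists_adjacent
  obtain ⟨c', hc', hα⟩ := H.exists_commutator_generator_eq hn ht h' hc
  have := h'.pairingIn_right δ
  rw [hα]
  exact H.commute_commutator hn (by omega) (by omega) hn le_rfl he ht.mem hc' hb

theorem commute_top_of_orthogonal (hδα : ⟪δ,α⟫ = 0) (hσα : ⟪σ,α⟫ = 1) (hσδ : ⟪σ,δ⟫ = 0)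
    (he : e ≤ n) (hb : b ∈ B e) (hc : c ∈ B (n + 1)) : Commute (x δ b) (x α c) := by
  obtain ⟨γ, h⟩ := exists_isSum_of_pairingIn_eq_one ((pairingIn_comm P α σ).trans hσα)
  obtain ⟨c', hc', hα⟩ := H.exists_commutator_generator_eq hn ht h hc
  have := h.pairingIn_right δ
  have := pairingIn_comm P δ σ
  rw [hα]
  exact H.commute_commutator hn (by omega) (by omega) hn le_rfl he ht.mem hc' hb

theorem commutator_top (h : IsSum P α δ ε) (he : e ≤ 0) (ha : a ∈ B (n + 1)) (hb : b ∈ B e) :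
    ⁅x α a, x δ b⁆ = x ε (N α δ • (a * b)) := by
  obtain ⟨μ, ν, κ, hα, hκ, hε, hνδ, hμε, σ, hσε, hσμ⟩ := h.exists_orthogonal_summand
  obtain ⟨a₀, ha₀, rfl⟩ := ht.exists_eq_mul (by omega) ha
  have ha₀' := zsmul_mem ha₀ (N μ ν)
  have htb := zsmul_mem (SetLike.mul_mem_graded (neg_mem ht.mem) hb) (N μ δ)
  have coeff_eq : N ν κ • (N μ ν • a₀ * N μ δ • (-t * b)) = N α δ • (t * a₀ * b) :=
    calc N ν κ • (N μ ν • a₀ * N μ δ • (-t * b))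
        = N ν κ • (-(N μ δ * N μ ν)) • (t * a₀ * b) := by
          simp only [zsmul_eq_mul, Int.cast_neg, Int.cast_mul]
          ring
      _ = N α δ • (t * a₀ * b) := by
          rw [IsStructureConstants.neg_mul_eq_mul N hα hκ hνδ h hε, mul_smul,
            IsStructureConstants.smul_smul N hε]
  have hcomm : Commute (x μ t) (x ε (N α δ • (t * a₀ * b))) := by
    have mem := zsmul_mem (SetLike.mul_mem_graded ha hb) (N α δ)
    rcases eq_or_lt_of_le he with rfl | he
    · exact H.commute_top_of_orthogonal hn ht hμε hσε hσμ hn ht.mem (by simpa using mem)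
    · exact H.commute (.inl hμε) hn (by omega) ht.mem mem
  rw [← H.commutator_generator hn ht hα ha₀,
    commutatorElement_commutatorElement_left (H.commute (.inl hνδ) le_rfl (by omega) ha₀' hb),
    ← H.map_neg μ hn ht.mem, H.commutator_eq hκ hn (by omega) (by omega) (neg_mem ht.mem) hb,
    H.map_neg μ hn ht.mem,
    H.commutator_eq_of_le hε le_rfl (by omega) (by omega) ha₀' htb, coeff_eq,
    hcomm.mul_inv_cancel]

theorem map_add_succ (i : ι) (hd : d ≤ n + 1) (ha : a ∈ B d) (hb : b ∈ B d) :
    x i (a + b) = x i a * x i b := by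
  rcases eq_or_lt_of_le hd with rfl | hd
  · exact H.map_add_top hn ht i ha hb
  · exact H.map_add i (by omega) ha hb

theorem map_neg_succ (i : ι) (hd : d ≤ n + 1) (ha : a ∈ B d) : x i (-a) = (x i a)⁻¹ := by
  have map_sub := H.map_add_succ hn ht i hd (neg_mem ha) ha
  rw [neg_add_cancel, H.map_zero] at map_sub
  exact eq_inv_of_mul_eq_one_left map_sub.symm

theorem commutator_eq_succ (h : IsSum P β γ α) (hd : d ≤ n + 1) (he : e ≤ n + 1)
    (hde : d + e ≤ n + 1) (ha : a ∈ B d) (hb : b ∈ B e) :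
    ⁅x β a, x γ b⁆ = x α (N β γ • (a * b)) := by
  rcases eq_or_lt_of_le hd with rfl | hd
  · exact H.commutator_top hn ht h (by omega) ha hb
  rcases eq_or_lt_of_le he with rfl | he
  · rw [← commutatorElement_inv, H.commutator_top hn ht h.symm (by omega) hb ha,
      ← H.map_neg_succ hn ht α (d := n + 1 + d) (by omega)
        (zsmul_mem (SetLike.mul_mem_graded hb ha) _), IsStructureConstants.swap (N := N) h,
      neg_smul, neg_neg, mul_comm]
  · exact H.commutator_eq_of_le h (by omega) (by omega) hde ha hb

theorem commute_mul_top (hαρ : ⟪α,ρ⟫ = 0) (hf : 1 ≤ f) (hfn : f ≤ n + 1) (hu : u ∈ B f)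
    (ha : a ∈ B (n + 1 - f)) : Commute (x ρ u) (x α (u * a)) := by
  obtain ⟨β, β', γ, κ, hβ, hκ, hβ'γ, hα, hα'⟩ := exists_isSum_of_pairingIn_eq_zero hαρ
  have one_mem := SetLike.one_mem_graded B
  have hs : N ρ β' • N β γ • a ∈ B (n + 1 - f) := zsmul_mem (zsmul_mem ha _) _
  have hus : N β γ • (u * a) ∈ B (n + 1) := by
    simpa using zsmul_mem (SetLike.mul_mem_graded hu ha) (N β γ)
  have huγ : N ρ γ • (-u * 1) ∈ B f := by simpa using zsmul_mem hu (N ρ γ)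
  have hβ_eq : ⁅x ρ u, x β' (N ρ β' • N β γ • a)⁆ = x β (N β γ • (u * a)) := by
    rw [H.commutator_eq_succ hn ht hβ hfn (by omega) (by omega) hu hs, mul_smul_comm,
      IsStructureConstants.smul_smul N hβ, mul_smul_comm]
  have hκ_eq : ⁅(x ρ u)⁻¹, x γ 1⁆ = x κ (N ρ γ • (-u * 1)) := by
    rw [← H.map_neg_succ hn ht ρ hfn hu,
      H.commutator_eq_succ hn ht hκ hfn (by omega) (by omega) (neg_mem hu) one_mem]
  have coeff_eq : N β' κ • (N ρ β' • N β γ • a * N ρ γ • (-u * 1)) = u * a :=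
    calc N β' κ • (N ρ β' • N β γ • a * N ρ γ • (-u * 1))
        = N β' κ • (-(N ρ γ * N ρ β')) • N β γ • (u * a) := by
          simp only [zsmul_eq_mul, Int.cast_neg, Int.cast_mul]
          ring
      _ = u * a := by
          rw [IsStructureConstants.neg_mul_eq_mul N hβ hκ hβ'γ hα hα', mul_smul,
            IsStructureConstants.smul_smul N hα', IsStructureConstants.smul_smul N hα]
  refine mul_inv_eq_iff_eq_mul.1 (Eq.symm ?_)
  calc x α (u * a) = ⁅x β (N β γ • (u * a)), x γ 1⁆ := by
        rw [H.commutator_eq_succ hn ht hα le_rfl (by omega) (by omega) hus one_mem, mul_one,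
          IsStructureConstants.smul_smul N hα]
    _ = x ρ u * x α (u * a) * (x ρ u)⁻¹ := by
        rw [← hβ_eq, commutatorElement_commutatorElement_left
          (H.commute (.inl hβ'γ) (by omega) (by omega) hs one_mem), hκ_eq,
          H.commutator_eq_succ hn ht hα' (by omega) hfn (by omega) hs huγ, coeff_eq]

theorem commute_top_of_commute_acute (hαρ : ⟪α,ρ⟫ = 0) (hf : 1 ≤ f) (hfn : f ≤ n + 1)
    (acute : ∀ (i j : ι) (a b : R), ⟪i,j⟫ = 1 → a ∈ B (n + 1) → b ∈ B f →
      Commute (x i a) (x j b))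
    (ha : a ∈ B (n + 1)) (hc : c ∈ B f) : Commute (x α a) (x ρ c) := by
  obtain ⟨β, γ, ε, hρ, hε, hαβ, hερ, hεβ⟩ := exists_isSum_acute_of_pairingIn_eq_zero hαρ
  lift f to ℕ using (by omega)
  have ht_pow := ht.pow_mem f
  obtain ⟨c₀, hc₀, rfl⟩ := ht.exists_eq_pow_mul f (d := 0) (c := c) le_rfl (by simpa using hc)
  have hc₀' := zsmul_mem hc₀ (N β γ)
  have hρ_eq : x ρ (t ^ f * c₀) = ⁅x β (t ^ f), x γ (N β γ • c₀)⁆ := by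
    rw [H.commutator_eq_succ hn ht hρ hfn (by omega) (by omega) ht_pow hc₀', mul_smul_comm,
      IsStructureConstants.smul_smul N hρ]
  have hw : N α γ • (a * N β γ • c₀) ∈ B (n + 1) := by
    simpa using zsmul_mem (SetLike.mul_mem_graded ha hc₀') (N α γ)
  have hε_eq : ⁅x α a, x γ (N β γ • c₀)⁆ = x ε (N α γ • (a * N β γ • c₀)) :=
    H.commutator_eq_succ hn ht hε le_rfl (by omega) (by omega) ha hc₀'
  have hεβ_comm : Commute (x ε (N α γ • (a * N β γ • c₀))) (x β (t ^ f)) := by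
    obtain ⟨w, hw, hw_eq⟩ := ht.exists_eq_pow_mul f (d := n + 1 - f) (by omega)
      (by rwa [sub_add_cancel])
    rw [hw_eq]
    exact (H.commute_mul_top hn ht hεβ hf hfn ht_pow hw).symm
  have hερ_comm := acute ε ρ _ _ hερ hw hc
  rw [hρ_eq, ← commutatorElement_inv] at hερ_comm ⊢
  refine (commute_commutatorElement_of_commute (acute α β _ _ hαβ ha ht_pow) ?_ ?_).inv_right <;>
    rw [hε_eq]
  · exact hεβ_comm
  · simpa using hερ_comm.inv_right

theorem commute_top_of_zero (hαρ : ⟪α,ρ⟫ = 0) (hf : f ≤ n) (ha : a ∈ B (n + 1)) (hc : c ∈ B f) :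
    Commute (x α a) (x ρ c) := by
  by_cases hf_pos : 1 ≤ f
  · exact H.commute_top_of_commute_acute hn ht hαρ hf_pos (by omega) (fun i j _ _ hij ha hb =>
      (H.commute_top_of_acute hn ht ((pairingIn_comm P j i).trans hij) hf hb ha).symm) ha hc
  · obtain ⟨β, hβα, hβρ⟩ := IsAmple.exists_acute_obtuse hαρ
    obtain ⟨γ, h⟩ := exists_isSum_of_pairingIn_eq_one ((pairingIn_comm P α β).trans hβα)
    obtain ⟨a', ha', hα⟩ := H.exists_commutator_generator_eq hn ht h ha
    have := h.pairingIn_right ρ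
    have := pairingIn_comm P ρ β
    have := pairingIn_comm P ρ α
    rw [hα]
    exact (H.commute_commutator_of_obtuse hn h.pairingIn_eq.1 (by omega) (by omega) hn le_rfl hf
      (by omega) ht.mem ha' hc).symm

theorem commute_top_top_of_acute (hαδ : ⟪α,δ⟫ = 1) (ha : a ∈ B (n + 1)) (hc : c ∈ B (n + 1)) :
    Commute (x α a) (x δ c) := by
  obtain ⟨ρ, hρα, hρδ, -⟩ := IsAmple.exists_orthogonal ((pairingIn_comm P δ α).trans hαδ)
  obtain ⟨μ, hδ⟩ := exists_isSum_of_pairingIn_eq_one ((pairingIn_comm P δ ρ).trans hρδ)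
  obtain ⟨c', hc', hδ_eq⟩ := H.exists_commutator_generator_eq hn ht hδ hc
  have := hδ.pairingIn_left α
  have := pairingIn_comm P α δ
  have := pairingIn_comm P α ρ
  rw [hδ_eq]
  exact commute_commutatorElement (H.commute_top_of_zero hn ht (by omega) hn ha ht.mem)
    (H.commute_top_of_acute hn ht (by omega) le_rfl hc' ha).symm

theorem commute_top (h : ⟪α,ρ⟫ = 0 ∨ ⟪α,ρ⟫ = 1) (hf : f ≤ n + 1) (ha : a ∈ B (n + 1))
    (hc : c ∈ B f) : Commute (x α a) (x ρ c) := by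
  rcases eq_or_lt_of_le hf with rfl | hf <;> rcases h with h | h
  · exact H.commute_top_of_commute_acute hn ht h (by omega) le_rfl
      (fun _ _ _ _ => H.commute_top_top_of_acute hn ht) ha hc
  · exact H.commute_top_top_of_acute hn ht h ha hc
  · exact H.commute_top_of_zero hn ht h (by omega) ha hc
  · exact (H.commute_top_of_acute hn ht ((pairingIn_comm P ρ α).trans h) (by omega) hc ha).symm

theorem isSteinbergFamily_succ : IsSteinbergFamily P N B (n + 1) x where
  map_add i _ _ _ := H.map_add_succ hn ht i
  commutator_eq := H.commutator_eq_succ hn ht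
  commute {i j d e a b} h hd he ha hb := by
    rcases eq_or_lt_of_le hd with rfl | hd
    · exact H.commute_top hn ht h he ha hb
    rcases eq_or_lt_of_le he with rfl | he
    · exact (H.commute_top hn ht (by rwa [pairingIn_comm P j i]) (by omega) hb ha).symm
    · exact H.commute h (by omega) (by omega) ha hb

end IsToppedFamily

theorem IsSteinbergFamily.exists_succ [GradedRing B] (H : IsSteinbergFamily P N B n x) (hn : 1 ≤ n)
    (ht : IsPolynomialGenerator B t) : ∃ y : ι → R → G, IsSteinbergFamily P N B (n + 1) y ∧
      ∀ i d a, d ≤ n → a ∈ B d → y i a = x i a := by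
  obtain ⟨y, hy, hyx⟩ := H.exists_isToppedFamily hn ht
  exact ⟨y, hy.isSteinbergFamily_succ hn ht, hyx⟩

end ToppedFamily

section GradedPieces

open scoped LaurentPolynomial

variable {A : Type*} [CommRing A] {M : Ideal A}

theorem mem_homB_iff {d : ℤ} {a : ringB M} :
    a ∈ homB M d ↔ ∀ e, e ≠ d → (a : A[T;T⁻¹]).coeff e = 0 := by
  change (a : A[T;T⁻¹]) ∈ AddMonoidAlgebra.grade A d ↔ _
  rw [AddMonoidAlgebra.mem_grade_iff]
  simp only [Finset.subset_singleton_iff', Finsupp.mem_support_iff]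
  exact forall_congr' fun e => not_imp_comm

variable (M) in
/-- The element `t` of `B`. -/
noncomputable def tB : ringB M :=
  ⟨LaurentPolynomial.T 1, fun d hd => by
    rw [LaurentPolynomial.T, AddMonoidAlgebra.coeff_single, Finsupp.single_eq_of_ne (by omega)]
    exact M.zero_mem⟩

/-- The homogeneous component of degree `d` of an element of `B`. -/
noncomputable def componentB (d : ℤ) (f : ringB M) : ringB M :=
  ⟨AddMonoidAlgebra.single d ((f : A[T;T⁻¹]).coeff d), fun e he => by
    rw [AddMonoidAlgebra.coeff_single]
    by_cases h : e = d
    · subst h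
      simpa using f.2 e he
    · rw [Finsupp.single_eq_of_ne h]
      exact M.zero_mem⟩

theorem componentB_mem_homB (d : ℤ) (f : ringB M) : componentB d f ∈ homB M d :=
  AddMonoidAlgebra.single_mem_grade _ _

theorem sum_componentB (f : ringB M) :
    ∑ d ∈ (f : A[T;T⁻¹]).coeff.support, componentB d f = f := by
  ext1
  rw [AddSubmonoidClass.coe_finsetSum]
  apply AddMonoidAlgebra.ext
  rw [AddMonoidAlgebra.coeff_sum]
  exact Finsupp.sum_single _

theorem isInternal_homB : DirectSum.IsInternal (homB M) := by
  constructor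
  · let toGrade (d : ℤ) : homB M d →+ AddMonoidAlgebra.grade A d :=
      { toFun := fun a => ⟨a.1.1, a.2⟩, map_zero' := rfl, map_add' := fun _ _ => rfl }
    have injective_toGrade (d : ℤ) : Function.Injective (toGrade d) := fun a b hab =>
      Subtype.ext (Subtype.ext (congrArg Subtype.val hab :))
    have comp_eq : (ringB M).subtype.toAddMonoidHom.comp (DirectSum.coeAddMonoidHom (homB M)) =
        (DirectSum.coeAddMonoidHom (AddMonoidAlgebra.grade A)).comp (DirectSum.map toGrade) := by
      ext d a : 2
      simp [toGrade]
    refine Function.Injective.of_comp (f := (ringB M).subtype.toAddMonoidHom) ?_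
    rw [← AddMonoidHom.coe_comp, comp_eq, AddMonoidHom.coe_comp]
    exact (AddMonoidAlgebra.grade.isInternal (R := A)).injective.comp
      ((DirectSum.map_injective _).2 injective_toGrade)
  · intro f
    rw [← sum_componentB f, ← AddMonoidHom.mem_range]
    exact sum_mem fun d _ => ⟨DirectSum.of (fun d => homB M d) d ⟨_, componentB_mem_homB d f⟩,
      DirectSum.coeAddMonoidHom_of _ _ _⟩

noncomputable instance : GradedRing (homB M) where
  toDecomposition := isInternal_homB.chooseDecomposition
  one_mem := SetLike.one_mem_graded (AddMonoidAlgebra.grade A (M := ℤ))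
  mul_mem _ _ _ _ ha hb := SetLike.mul_mem_graded (A := AddMonoidAlgebra.grade A (M := ℤ)) ha hb

theorem isPolynomialGenerator_tB : IsPolynomialGenerator (homB M) (tB M) where
  mem := AddMonoidAlgebra.single_mem_grade _ _
  isLeftRegular := fun a b h => Subtype.ext
    ((LaurentPolynomial.isUnit_T 1).mul_left_cancel (congrArg Subtype.val h))
  exists_eq_mul := by
    intro d c hd hc
    rw [mem_homB_iff] at hc
    have coeff_T_mul (e : ℤ) : (LaurentPolynomial.T (-1) * (c : A[T;T⁻¹])).coeff e =
        (c : A[T;T⁻¹]).coeff (e + 1) := by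
      rw [LaurentPolynomial.T, AddMonoidAlgebra.coeff_single_mul_apply, one_mul]
      congr 1
      ring
    refine ⟨⟨LaurentPolynomial.T (-1) * (c : A[T;T⁻¹]), fun e he => ?_⟩,
      mem_homB_iff.2 fun e he => ?_, ?_⟩
    · rw [coeff_T_mul, hc _ (by omega)]
      exact M.zero_mem
    · exact (coeff_T_mul e).trans (hc _ (by omega))
    · ext1
      change (c : A[T;T⁻¹]) = LaurentPolynomial.T 1 * (LaurentPolynomial.T (-1) * (c : A[T;T⁻¹]))
      rw [← mul_assoc, ← LaurentPolynomial.T_add, add_neg_cancel, LaurentPolynomial.T_zero, one_mul]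

end GradedPieces

section AdditiveExtension

variable {ι M σ G : Type*} [DecidableEq ι] [AddCommMonoid M] [SetLike σ M] [AddSubmonoidClass σ M]
  [Group G]

open DirectSum in
open scoped IsMulCommutative in
theorem exists_additive_extension (ℳ : ι → σ) [Decomposition ℳ] (z : M → G)
    (map_zero : z 0 = 1)
    (map_add : ∀ i, ∀ a ∈ ℳ i, ∀ b ∈ ℳ i, z (a + b) = z a * z b)
    (commute : ∀ i j, ∀ a ∈ ℳ i, ∀ b ∈ ℳ j, Commute (z a) (z b)) :
    ∃ y : M → G, (∀ f g, y (f + g) = y f * y g) ∧ ∀ i, ∀ a ∈ ℳ i, y a = z a := by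
  let H : Subgroup G := Subgroup.closure {g | ∃ i, ∃ a ∈ ℳ i, z a = g}
  have isMulCommutative : IsMulCommutative H := Subgroup.isMulCommutative_closure (by
    rintro _ ⟨i, a, ha, rfl⟩ _ ⟨j, b, hb, rfl⟩
    exact commute i j a ha b hb)
  let component (i : ι) : ℳ i →+ Additive H :=
    { toFun a := Additive.ofMul ⟨z a, Subgroup.subset_closure ⟨i, a, a.2, rfl⟩⟩
      map_zero' := congrArg Additive.ofMul (Subtype.ext map_zero)
      map_add' a b := congrArg Additive.ofMul (Subtype.ext (map_add i a a.2 b b.2)) }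
  refine ⟨fun f => (Additive.toMul (toAddMonoid component (decompose ℳ f)) : H), fun f g => ?_,
    fun i a ha => ?_⟩
  · simp only [decompose_add, _root_.map_add, toMul_add, Subgroup.coe_mul]
  · simp only [decompose_of_mem ℳ ha, toAddMonoid_of]
    rfl

end AdditiveExtension

namespace IsSteinbergFamily

variable {ι K V W R G : Type*} [Field K] [CharZero K] [AddCommGroup V] [Module K V]
  [AddCommGroup W] [Module K W] {P : RootPairing ι K V W} [P.IsCrystallographic]
  [IsSimplyLaced P] [IsAmple P] [CommRing R] [Group G] {N : ι → ι → ℤ} [IsStructureConstants P N]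
  {B : ℤ → AddSubgroup R}

local notation "⟪" i "," j "⟫" => RootPairing.pairingIn P ℤ i j

section AllDegrees

variable [GradedRing B] {t : R} {n : ℤ} {x : ι → R → G}

omit [CharZero K] [IsSimplyLaced P] [IsAmple P] [IsStructureConstants P N] [GradedRing B] in
theorem mono {m : ℤ} (H : IsSteinbergFamily P N B n x) (hmn : m ≤ n) :
    IsSteinbergFamily P N B m x where
  map_add i _ _ _ hd ha hb := H.map_add i (hd.trans hmn) ha hb
  commutator_eq h hd he hde ha hb :=
    H.commutator_eq h (hd.trans hmn) (he.trans hmn) (hde.trans hmn) ha hb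
  commute h hd he ha hb := H.commute h (hd.trans hmn) (he.trans hmn) ha hb

theorem exists_seq (H : IsSteinbergFamily P N B n x) (hn : 1 ≤ n)
    (ht : IsPolynomialGenerator B t) :
    ∃ F : ℕ → ι → R → G, F 0 = x ∧ (∀ k : ℕ, IsSteinbergFamily P N B (n + k) (F k)) ∧
      ∀ k m : ℕ, k ≤ m → ∀ i d a, d ≤ n + k → a ∈ B d → F m i a = F k i a := by
  have exists_next (k : ℕ) (u : {u : ι → R → G // IsSteinbergFamily P N B (n + k) u}) :
      ∃ v : {v : ι → R → G // IsSteinbergFamily P N B (n + (k + 1 : ℕ)) v},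
        ∀ i d a, d ≤ n + k → a ∈ B d → v.1 i a = u.1 i a := by
    obtain ⟨v, hv, hvu⟩ := u.2.exists_succ (by omega) ht
    exact ⟨⟨v, by rwa [Nat.cast_succ, ← add_assoc]⟩, hvu⟩
  choose next hnext using exists_next
  let F (k : ℕ) : {u : ι → R → G // IsSteinbergFamily P N B (n + k) u} :=
    Nat.rec ⟨x, by simpa using H⟩ next k
  refine ⟨fun k => (F k).1, rfl, fun k => (F k).2, fun k m hkm i d a hd ha => ?_⟩
  induction m, hkm using Nat.le_induction with
  | base => rfl
  | succ m hkm ih => exact (hnext m (F m) i d a (by omega) ha).trans ih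

theorem exists_forall (H : IsSteinbergFamily P N B n x) (hn : 1 ≤ n)
    (ht : IsPolynomialGenerator B t) :
    ∃ y : ι → R → G, (∀ m, IsSteinbergFamily P N B m y) ∧
      ∀ i d a, d ≤ n → a ∈ B d → y i a = x i a := by
  obtain ⟨F, rfl, hF, hFF⟩ := H.exists_seq hn ht
  have exists_limit (i : ι) (a : R) :
      ∃ z, ∀ (k : ℕ) (d : ℤ), d ≤ n + k → a ∈ B d → F k i a = z := by
    by_cases hex : ∃ d, a ∈ B d
    · obtain ⟨d, ha⟩ := hex
      refine ⟨F (d - n).toNat i a, fun k e he hae => ?_⟩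
      rcases le_total k (d - n).toNat with hk | hk
      · exact (hFF k _ hk i e a he hae).symm
      · exact hFF _ k hk i d a (by omega) ha
    · exact ⟨1, fun k d _ ha => (hex ⟨d, ha⟩).elim⟩
  choose y hy using exists_limit
  refine ⟨y, fun m => ?_, fun i d a hd ha => (hy i a 0 d (by simpa using hd) ha).symm⟩
  exact ((hF (m - n).toNat).congr fun i d a hd ha => (hy i a _ d hd ha).symm).mono (by omega)

omit [CharZero K] [GradedRing B] in
theorem mem_of_forall_mem_succ {Q : Subgroup G} (H : IsSteinbergFamily P N B (n + 1) x)
    (hn : 1 ≤ n) (ht : IsPolynomialGenerator B t) (hQ : ∀ i d a, d ≤ n → a ∈ B d → x i a ∈ Q)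
    (i : ι) {d : ℤ} {a : R} (hd : d ≤ n + 1) (ha : a ∈ B d) : x i a ∈ Q := by
  obtain hdn | rfl := Int.le_add_one_iff.1 hd
  · exact hQ i d a hdn ha
  obtain ⟨β, γ, h⟩ := exists_isSum_left_right (P := P) i
  obtain ⟨c, hc, rfl⟩ := ht.exists_eq_mul (by omega) ha
  have hc' := zsmul_mem hc (N β γ)
  have commutator_eq := H.commutator_eq h (by omega) (by omega) (by omega) ht.mem hc'
  rw [mul_smul_comm, IsStructureConstants.smul_smul N h] at commutator_eq
  have hβ := hQ β 1 t hn ht.mem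
  have hγ := hQ γ n _ le_rfl hc'
  rw [← commutator_eq]
  exact Q.mul_mem (Q.mul_mem (Q.mul_mem hβ hγ) (Q.inv_mem hβ)) (Q.inv_mem hγ)

omit [CharZero K] [GradedRing B] in
theorem mem_of_forall_mem {Q : Subgroup G} (H : ∀ m, IsSteinbergFamily P N B m x) (hn : 1 ≤ n)
    (ht : IsPolynomialGenerator B t) (hQ : ∀ i d a, d ≤ n → a ∈ B d → x i a ∈ Q)
    (i : ι) {d : ℤ} {a : R} (ha : a ∈ B d) : x i a ∈ Q := by
  have mem_of_le (m : ℤ) (hm : n ≤ m) : ∀ i d a, d ≤ m → a ∈ B d → x i a ∈ Q := by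
    induction m, hm using Int.leInduction with
    | base => exact hQ
    | succ m hm ih =>
      exact fun i d a hd ha => (H (m + 1)).mem_of_forall_mem_succ (by omega) ht ih i hd ha
  exact mem_of_le (max n d) (le_max_left n d) i d a (le_max_right n d) ha

end AllDegrees

section Additive

variable [GradedRing B] {x y : ι → R → G} (H : ∀ m, IsSteinbergFamily P N B m x)
  (map_add_y : ∀ i a b, y i (a + b) = y i a * y i b)
  (y_eq : ∀ i d, ∀ a ∈ B d, y i a = x i a)
include H map_add_y y_eq

theorem commute_of_map_add {i j : ι} (h : 0 ≤ ⟪i,j⟫) (a b : R) : Commute (y i a) (y j b) := by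
  have map_zero (i : ι) : y i 0 = 1 := by simpa using map_add_y i 0 0
  induction a using DirectSum.Decomposition.inductionOn B with
  | zero => simp only [map_zero, Commute.one_left]
  | @homogeneous d a =>
    induction b using DirectSum.Decomposition.inductionOn B with
    | zero => simp only [map_zero, Commute.one_right]
    | @homogeneous e b =>
      rw [y_eq i d a a.2, y_eq j e b b.2]
      exact (H (max 1 (max d e))).commute_of_nonneg (by omega) h (by omega) (by omega) a.2 b.2
    | add b b' hb hb' => exact map_add_y j b b' ▸ hb.mul_right hb'
  | add a a' ha ha' => exact map_add_y i a a' ▸ ha.mul_left ha'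

theorem commutator_eq_of_map_add {i j k : ι} (h : IsSum P i j k) (a b : R) :
    ⁅y i a, y j b⁆ = y k (N i j • (a * b)) := by
  have map_zero (i : ι) : y i 0 = 1 := by simpa using map_add_y i 0 0
  have commute_sum {l : ι} (hl : ⟪l,k⟫ = 1) :=
    commute_of_map_add H map_add_y y_eq (zero_le_one.trans hl.ge)
  obtain ⟨-, hik, hjk⟩ := h.pairingIn_eq
  induction a using DirectSum.Decomposition.inductionOn B with
  | zero => simp only [map_zero, commutatorElement_one_left, zero_mul, smul_zero]
  | @homogeneous d a =>
    induction b using DirectSum.Decomposition.inductionOn B with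
    | zero => simp only [map_zero, commutatorElement_one_right, mul_zero, smul_zero]
    | @homogeneous e b =>
      rw [y_eq i d a a.2, y_eq j e b b.2,
        y_eq k (d + e) _ (zsmul_mem (SetLike.mul_mem_graded a.2 b.2) _)]
      exact (H (max (max d e) (d + e))).commutator_eq h (by omega) (by omega) (by omega) a.2 b.2
    | add b b' hb hb' =>
      rw [map_add_y, commutatorElement_mul_right_of_commute (hb' ▸ commute_sum hjk _ _), hb, hb',
        ← map_add_y, mul_add, smul_add]
  | add a a' ha ha' =>
    rw [map_add_y, commutatorElement_mul_left_of_commute (ha' ▸ commute_sum hik _ _), ha, ha',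
      ← map_add_y, add_mul, smul_add, add_comm]

end Additive

-- The conclusion encodes the ungraded Steinberg relations: every element of `R` has degree `0` in
-- the constant family `⊤`.
theorem exists_total [GradedRing B] {x : ι → R → G} (H : ∀ m, IsSteinbergFamily P N B m x) :
    ∃ y : ι → R → G, IsSteinbergFamily P N (fun _ => ⊤) 0 y ∧ ∀ i d, ∀ a ∈ B d, y i a = x i a := by
  have exists_extension (i : ι) := exists_additive_extension B (x i) ((H 0).map_zero i)
    (fun d a ha b hb => (H d).map_add i le_rfl ha hb)
    (fun d e a ha b hb => (H (max 1 (max d e))).commute_self (by omega) i (by omega) (by omega)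
      ha hb)
  choose y map_add_y y_eq using exists_extension
  exact ⟨y, {
    map_add := fun i _ a b _ _ _ => map_add_y i a b
    commutator_eq := fun h _ _ _ _ _ => commutator_eq_of_map_add H map_add_y y_eq h _ _
    commute := fun h _ _ _ _ => commute_of_map_add H map_add_y y_eq (by omega) _ _ }, y_eq⟩

end IsSteinbergFamily

section SteinbergGroups

variable {ι K V W A S G : Type*} [Field K] [AddCommGroup V] [Module K V]
  [AddCommGroup W] [Module K W] {P : RootPairing ι K V W} {N : ι → ι → ℤ} [CommRing A] {M : Ideal A}
  {n : ℤ} [CommRing S] [Group G]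

namespace Steinberg

theorem x_add (i : ι) (a b : S) : x P N i (a + b) = x P N i a * x P N i b :=
  (mul_inv_eq_one.1 (PresentedGroup.one_of_mem (SteinbergRel.add i a b))).symm

end Steinberg

namespace TruncSteinberg

theorem incl_x (i : ι) (a : HomCoeff M n) : incl P N M n (x P N M i a) = x P N M i a.succ :=
  PresentedGroup.toGroup.of _

open Classical in
variable (P N M) in
/-- The generators of the truncated Steinberg group as a family indexed by all elements of `B`, with
the junk value `1` at the elements that are not homogeneous of degree at most `n`. -/
noncomputable def family (n : ℤ) (i : ι) (a : ringB M) : TruncSteinberg P N M n :=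
  if h : ∃ d : ℤ, d ≤ n ∧ a ∈ homB M d then x P N M i ⟨a, h⟩ else 1

theorem family_of_mem (i : ι) {d : ℤ} (hd : d ≤ n) {a : ringB M} (ha : a ∈ homB M d) :
    family P N M n i a = x P N M i ⟨a, d, hd, ha⟩ :=
  dif_pos _

theorem injective_of_apply_x {ψ : TruncSteinberg P N M n →* G}
    {χ : G →* TruncSteinberg P N M n} (h : ∀ i a, χ (ψ (x P N M i a)) = x P N M i a) :
    Function.Injective ψ :=
  Function.LeftInverse.injective (g := χ)
    (DFunLike.congr_fun (PresentedGroup.ext fun g => h g.1 g.2 : χ.comp ψ = MonoidHom.id _))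

end TruncSteinberg

variable [CharZero K] [P.IsCrystallographic] [IsSimplyLaced P]

local notation "⟪" i "," j "⟫" => RootPairing.pairingIn P ℤ i j

theorem sub_mem_range_root_iff {i j : ι} :
    P.root i - P.root j ∈ Set.range P.root ↔ ⟪i,j⟫ = 1 := by
  constructor
  · rintro ⟨k, hk⟩
    have h : IsSum P j k i := by rw [IsSum, hk, add_sub_cancel]
    exact (pairingIn_comm P i j).trans h.pairingIn_eq.2.1
  · intro h
    obtain ⟨k, hk⟩ := exists_isSum_of_pairingIn_eq_one h
    exact ⟨k, (sub_eq_of_eq_add' hk).symm⟩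

theorem eq_or_pairingIn_eq_of_add_notMem_range_root {i j : ι} (h0 : P.root i + P.root j ≠ 0)
    (h : P.root i + P.root j ∉ Set.range P.root) : i = j ∨ ⟪i,j⟫ = 0 ∨ ⟪i,j⟫ = 1 := by
  obtain hij | rfl | hij | hij | hij := eq_or_eq_reflectionPerm_self_or (P := P) i j
  · exact .inl hij
  · exact absurd (by rw [root_reflectionPerm_self, neg_add_cancel]) h0
  · exact .inr (.inr hij)
  · exact .inr (.inl hij)
  · exact absurd (exists_isSum hij) h

namespace Steinberg

theorem isSteinbergFamily_x (B : ℤ → AddSubgroup S) : IsSteinbergFamily P N B n (x P N) where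
  map_add i _ a b _ _ _ := x_add i a b
  commutator_eq {i j k _ _ a b} h _ _ _ _ _ :=
    mul_inv_eq_one.1 (PresentedGroup.one_of_mem (SteinbergRel.comm_add i j k a b h))
  commute {i j _ _ a b} h _ _ _ _ :=
    commutatorElement_eq_one_iff_commute.1 (PresentedGroup.one_of_mem (SteinbergRel.comm_one i j a b
      (add_root_ne_zero (by omega)) (add_root_notMem_range_root (by omega))))

/-- The universal property of the Steinberg group. -/
def lift {y : ι → S → G} (H : IsSteinbergFamily P N (fun _ => ⊤) 0 y) : Steinberg P N S →* G :=
  PresentedGroup.toGroup (f := fun g : ι × S => y g.1 g.2) <| by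
    have map_add (i : ι) (a b : S) := H.map_add i (d := 0) (a := a) (b := b) le_rfl trivial trivial
    rintro r (hr : SteinbergRel P N S r)
    cases hr with
    | add i a b =>
      simp only [map_mul, map_inv, FreeGroup.lift_apply_of, map_add, mul_inv_cancel]
    | comm_add i j k a b hk =>
      simp only [map_mul, map_inv, map_commutatorElement, FreeGroup.lift_apply_of]
      rw [H.commutator_eq hk (d := 0) (e := 0) le_rfl le_rfl le_rfl trivial trivial, mul_inv_cancel]
    | comm_one i j a b h0 h =>
      simp only [map_commutatorElement, FreeGroup.lift_apply_of]
      rw [commutatorElement_eq_one_iff_commute]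
      obtain rfl | hij := eq_or_pairingIn_eq_of_add_notMem_range_root h0 h
      · rw [commute_iff_eq, ← map_add, ← map_add, add_comm]
      · exact H.commute hij (d := 0) (e := 0) le_rfl le_rfl trivial trivial

theorem lift_x {y : ι → S → G} (H : IsSteinbergFamily P N (fun _ => ⊤) 0 y) (i : ι) (a : S) :
    lift H (x P N i a) = y i a :=
  PresentedGroup.toGroup.of _

end Steinberg

namespace TruncSteinberg

/-- The universal property of the truncated Steinberg group. -/
def lift {y : ι → ringB M → G} (H : IsSteinbergFamily P N (homB M) n y) :
    TruncSteinberg P N M n →* G :=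
  PresentedGroup.toGroup (f := fun g : ι × HomCoeff M n => y g.1 g.2.1) <| by
    rintro r (hr : TruncRel P N M n r)
    cases hr with
    | add i d hd a b c ha hb hc =>
      simp only [map_mul, map_inv, FreeGroup.lift_apply_of]
      rw [hc, H.map_add i hd ha hb, mul_inv_cancel]
    | comm_add i j k hk d e hd he hde a b c ha hb hc =>
      simp only [map_mul, map_inv, map_commutatorElement, FreeGroup.lift_apply_of]
      rw [hc, H.commutator_eq hk hd he hde ha hb, mul_inv_cancel]
    | comm_acute i j h d e hd he a b ha hb =>
      simp only [map_commutatorElement, FreeGroup.lift_apply_of]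
      exact commutatorElement_eq_one_iff_commute.2
        (H.commute (.inr (sub_mem_range_root_iff.1 h)) hd he ha hb)
    | comm_orthogonal i j h d e hd he a b ha hb =>
      simp only [map_commutatorElement, FreeGroup.lift_apply_of]
      exact commutatorElement_eq_one_iff_commute.2
        (H.commute (.inl (isOrthogonal_iff_pairingIn_eq_zero.1 h)) hd he ha hb)

theorem lift_x {y : ι → ringB M → G} (H : IsSteinbergFamily P N (homB M) n y) (i : ι)
    (a : HomCoeff M n) : lift H (x P N M i a) = y i a.1 :=
  PresentedGroup.toGroup.of _

theorem isSteinbergFamily_family : IsSteinbergFamily P N (homB M) n (family P N M n) where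
  map_add i d a b hd ha hb := by
    rw [family_of_mem i hd ha, family_of_mem i hd hb, family_of_mem i hd (add_mem ha hb)]
    exact (mul_inv_eq_one.1 (PresentedGroup.one_of_mem (TruncRel.add i d hd _ _ _ ha hb rfl))).symm
  commutator_eq {i j k d e a b} h hd he hde ha hb := by
    rw [family_of_mem i hd ha, family_of_mem j he hb,
      family_of_mem k hde (zsmul_mem (SetLike.mul_mem_graded ha hb) _)]
    exact mul_inv_eq_one.1 (PresentedGroup.one_of_mem
      (TruncRel.comm_add i j k h d e hd he hde _ _ _ ha hb rfl))
  commute {i j d e a b} h hd he ha hb := by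
    rw [family_of_mem i hd ha, family_of_mem j he hb, ← commutatorElement_eq_one_iff_commute]
    obtain h | h := h
    · exact PresentedGroup.one_of_mem (TruncRel.comm_orthogonal i j
        (isOrthogonal_iff_pairingIn_eq_zero.2 h) d e hd he _ _ ha hb)
    · exact PresentedGroup.one_of_mem (TruncRel.comm_acute i j
        (sub_mem_range_root_iff.2 h) d e hd he _ _ ha hb)

variable (P N M) in
/-- The homomorphism `St^{≤ n}(P, B) → St(P, B)`, `x_i(a) ↦ x_i(a)`. -/
noncomputable def toSteinberg (n : ℤ) : TruncSteinberg P N M n →* Steinberg P N (ringB M) :=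
  lift (Steinberg.isSteinbergFamily_x (homB M))

theorem toSteinberg_x (i : ι) (a : HomCoeff M n) :
    toSteinberg P N M n (x P N M i a) = Steinberg.x P N i a.1 :=
  lift_x _ i a

variable [IsAmple P] [IsStructureConstants P N]

theorem injective_incl (hn : 1 ≤ n) : Function.Injective (incl P N M n) := by
  obtain ⟨y, hy, y_eq⟩ :=
    (isSteinbergFamily_family (P := P) (N := N)).exists_succ hn (isPolynomialGenerator_tB (M := M))
  refine injective_of_apply_x (χ := lift hy) fun i a => ?_
  obtain ⟨a, d, hd, ha⟩ := a
  rw [incl_x, lift_x]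
  exact (y_eq i d a hd ha).trans (family_of_mem i hd ha)

theorem surjective_incl (hn : 1 ≤ n) : Function.Surjective (incl P N M n) := by
  refine fun g => PresentedGroup.generated_by _ (incl P N M n).range (fun ⟨i, a, d, hd, ha⟩ => ?_) g
  change x P N M i ⟨a, d, hd, ha⟩ ∈ _
  rw [← family_of_mem i hd ha]
  refine isSteinbergFamily_family.mem_of_forall_mem_succ
    (Q := (incl P N M n).range) hn isPolynomialGenerator_tB (fun i e b he hb => ?_) i hd ha
  refine ⟨x P N M i ⟨b, e, he, hb⟩, ?_⟩
  rw [incl_x]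
  exact (family_of_mem i (by omega) hb).symm

theorem injective_toSteinberg (hn : 1 ≤ n) : Function.Injective (toSteinberg P N M n) := by
  obtain ⟨y, hy, y_eq⟩ := (isSteinbergFamily_family (P := P) (N := N)).exists_forall hn
    (isPolynomialGenerator_tB (M := M))
  obtain ⟨z, hz, z_eq⟩ := IsSteinbergFamily.exists_total hy
  refine injective_of_apply_x (χ := Steinberg.lift hz) fun i a => ?_
  obtain ⟨a, d, hd, ha⟩ := a
  rw [toSteinberg_x, Steinberg.lift_x]
  exact (z_eq i d a ha).trans ((y_eq i d a hd ha).trans (family_of_mem i hd ha))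

theorem surjective_toSteinberg (hn : 1 ≤ n) : Function.Surjective (toSteinberg P N M n) := by
  refine fun g => PresentedGroup.generated_by _ (toSteinberg P N M n).range (fun ⟨i, f⟩ => ?_) g
  change Steinberg.x P N i f ∈ _
  have mem_of_homogeneous {d : ℤ} {a : ringB M} (ha : a ∈ homB M d) :
      Steinberg.x P N i a ∈ (toSteinberg P N M n).range :=
    IsSteinbergFamily.mem_of_forall_mem (Q := (toSteinberg P N M n).range)
      (fun m => Steinberg.isSteinbergFamily_x (homB M)) hn
      isPolynomialGenerator_tB (fun i e b he hb => ⟨x P N M i ⟨b, e, he, hb⟩, toSteinberg_x i _⟩)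
      i ha
  induction f using DirectSum.Decomposition.inductionOn (homB M) with
  | zero => exact mem_of_homogeneous (zero_mem (homB M 0))
  | homogeneous a => exact mem_of_homogeneous a.2
  | add a b ha hb => exact Steinberg.x_add (P := P) (N := N) i a b ▸ mul_mem ha hb

end TruncSteinberg

end SteinbergGroups

end GradedSteinberg

open GradedSteinberg in
theorem mainTheorem4_general {ι K V W A : Type*} [Field K] [CharZero K]
    [AddCommGroup V] [Module K V] [AddCommGroup W] [Module K W]
    (P : RootPairing ι K V W) [P.IsCrystallographic] [IsSimplyLaced P] [IsAmple P]
    (N : ι → ι → ℤ) [IsStructureConstants P N] [CommRing A] (M : Ideal A) :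
    (∀ n : ℤ, 1 ≤ n → Function.Bijective (TruncSteinberg.incl P N M n)) ∧
    ∃ φ : TruncSteinberg P N M 1 →* Steinberg P N (ringB M),
      (∀ (i : ι) (a : HomCoeff M 1),
        φ (TruncSteinberg.x P N M i a) = Steinberg.x P N i a.1) ∧
      Function.Bijective φ :=
  ⟨fun _ hn => ⟨TruncSteinberg.injective_incl hn, TruncSteinberg.surjective_incl hn⟩,
    TruncSteinberg.toSteinberg P N M 1, TruncSteinberg.toSteinberg_x,
    TruncSteinberg.injective_toSteinberg le_rfl, TruncSteinberg.surjective_toSteinberg le_rfl⟩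

open GradedSteinberg in
theorem mainTheorem4 {ι K V W L A : Type*} [Finite ι] [Field K] [CharZero K]
    [AddCommGroup V] [Module K V] [AddCommGroup W] [Module K W]
    (P : RootPairing ι K V W) [P.IsRootSystem] [P.IsCrystallographic] [P.IsReduced]
    (hP : IsTypeADE P)
    [LieRing L] [LieAlgebra K L] (𝓒 : ChevalleyBasis P L)
    [CommRing A] (M : Ideal A) :
    (∀ n : ℤ, 1 ≤ n → Function.Bijective (TruncSteinberg.incl P 𝓒.N M n)) ∧
    ∃ φ : TruncSteinberg P 𝓒.N M 1 →* Steinberg P 𝓒.N (ringB M),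
      (∀ (i : ι) (a : HomCoeff M 1),
        φ (TruncSteinberg.x P 𝓒.N M i a) = Steinberg.x P 𝓒.N i a.1) ∧
      Function.Bijective φ := by
  have := hP.isSimplyLaced
  have := hP.isAmple
  exact mainTheorem4_general P 𝓒.N M
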